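/- Let $n\ge 0$ and let $X$ be a finite multiset of nonzero vectors that spans $\mathbb{R}^n$, equipped with an arbitrary total order $\prec$ (repeated vectors are distinct elements of $X$, and all subsets and cardinalities are taken with multiplicity). **Notation.** Let $\Pi=\mathbb{C}[t_1,\dots,t_n]$. For $p\in\Pi$ and a formal power series $f\in\mathbb{C}[[t_1,\dots,t_n]]$ let $p(D)=p(\partial/\partial t_1,\dots,\partial/\partial t_n)$ and $\langle p,f\rangle=(p(D)f)(0)$. Let $e_\alpha(t)=e^{\alpha\cdot t}$. For an ideal $I\subset\Pi$ with variety $\mathrm{Var}(I)\subset\mathbb{C}^n$, let $$\ker I=\mathrm{span}\{e_\alpha p:\ \alpha\in\mathrm{Var}(I),\ p\in\Pi,\ \langle q,e_\alpha p\rangle=0\ \ \forall q\in I\}.$$ For a power series $f\neq0$ let $f_\downarrow$ be its nonzero homogeneous component of lowest degree, and $0_\downarrow=0$. For a finite $\sigma\subset\mathbb{R}^n$ let $\Pi(\sigma)=\mathrm{span}\{f_\downarrow: f\in\mathrm{span}\{e_\alpha:\alpha\in\sigma\}\}$; $\sigma$ is *correct* for a subspace $P\subset\Pi$ if the restriction $P\to\mathbb{C}^\sigma$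 is bijective. For $x\in\mathbb{R}^n$ put $p_x(t)=x\cdot t$, and for $Y\subset X$ put $p_Y=\prod_{y\in Y}p_y$. * $\mathbb{B}_-(X)$ is the set of internal bases: those $B\subset X$ that are bases of $\mathbb{R}^n$ and such that no $b\in B$ is the $\prec$-last element of $X\setminus\mathrm{span}(B\setminus b)$. * $L_-(X)$ is the set of $Y\subset X$ that meet every $B\in\mathbb{B}_-(X)$; $\mathcal{J}_-(X)$ is the ideal generated by $\{p_Y:Y\in L_-(X)\}$; and $\mathcal{D}_-(X)=\{f\in\Pi: p_Y(D)f=0\ \ \forall\,Y\in L_-(X)\}$. * $\mathcal{P}_-(X)=\bigcap_{x\in X}\mathcal{P}(X\setminus x)$, where $\mathcal{P}(A)=\mathrm{span}\{p_Y: Y\subset A,\ \mathrm{rank}(A\setminus Y)=n\}$ for $A\subset X$ (so $\mathcal{P}(A)=0$ if $A$ does not span $\mathbb{R}^n$; an empty intersection is $\Pi$). * $\mathcal{I}_-(X)$ is the ideal generated by the polynomials $p_{\eta_H}^{m(H)-1}$, where $H$ runs over the linear hyperplanes of $\mathbb{R}^n$ spanned by vectors of $X$, $\eta_H\ne0$ is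 a normal of $H$, and $m(H)=\#(X\setminus H)$. * For $\lambda\in\mathbb{R}^X$, generic in the sense that no $n+1$ of the hyperplanes $\{t: x\cdot t=\lambda_x\}$, $x\in X$, have a common point, $V_-(X,\lambda)$ is the set of the points $v_B$, $B\in\mathbb{B}_-(X)$, where $v_B$ is the unique common point of the hyperplanes with $x\in B$. **Theorem.** 1. $\mathcal{P}_-(X)$ and $\mathcal{D}_-(X)$ are finite-dimensional and $\dim\mathcal{P}_-(X)=\dim\mathcal{D}_-(X)=\#\mathbb{B}_-(X)$. 2. The map $p\mapsto\langle p,\cdot\rangle$ is a bijection from $\mathcal{D}_-(X)$ onto the dual space $\mathcal{P}_-(X)'$. 3. $\mathcal{D}_-(X)=\ker\mathcal{J}_-(X)$, and $\mathcal{D}_-(X)=\Pi(V_-(X,\lambda))$ for every generic $\lambda$. 4. For every generic $\lambda$, the set $V_-(X,\lambda)$ is correct for $\mathcal{D}_-(X)$ as well as for $\mathcal{P}_-(X)$. 5. $\mathcal{P}_-(X)=\ker\mathcal{I}_-(X)$. 6. $\Pi=\mathcal{P}_-(X)\oplus\mathcal{J}_-(X)$. -/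

import Mathlib

/-!  Zonotopal algebra: polynomial spaces and ideals attached to a finite ordered multiset of
vectors `X : ι → ℝⁿ`.  A sub-multiset of `X` is a finset of indices, so repeated vectors are
distinct elements of the multiset.  -/

namespace ZonotopalAlgebra

open MvPolynomial

/-- `Π = ℂ[t₁, …, tₙ]`. -/
abbrev Poly (n : ℕ) : Type := MvPolynomial (Fin n) ℂ

/-- `ℂ[[t₁, …, tₙ]]`. -/
abbrev Series (n : ℕ) : Type := MvPowerSeries (Fin n) ℂ

/-- The inclusion of polynomials into formal power series. -/
noncomputable def toSeries (n : ℕ) : Poly n →ₗ[ℂ] Series n :=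
  (coeToMvPowerSeries.algHom (σ := Fin n) (R := ℂ) ℂ).toLinearMap

/-! ### Differential operators, pairing, kernels of ideals -/

/-- `D^a = ∂₁^{a₁} ⋯ ∂ₙ^{aₙ}` on formal power series. -/
noncomputable def partialPow {n : ℕ} (a : Fin n →₀ ℕ) : Module.End ℂ (Series n) :=
  (List.ofFn fun i : Fin n =>
    ((MvPowerSeries.pderiv ℂ i : Series n →ₗ[ℂ] Series n) : Module.End ℂ (Series n)) ^ a i).prod

/-- The differential operator `p(D)` on formal power series. -/
noncomputable def diffOp {n : ℕ} (p : Poly n) : Module.End ℂ (Series n) :=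
  ∑ a ∈ p.support, p.coeff a • partialPow a

/-- The pairing `⟨p, f⟩ = (p(D) f)(0)`, as a linear functional of the power series `f`. -/
noncomputable def pairing {n : ℕ} (p : Poly n) : Series n →ₗ[ℂ] ℂ :=
  (MvPowerSeries.coeff (0 : Fin n →₀ ℕ)).comp (diffOp p)

/-- The exponential `e_α(t) = exp(α · t)` as a formal power series. -/
noncomputable def expSeries {n : ℕ} (α : Fin n → ℂ) : Series n :=
  fun a => ∏ i, α i ^ a i / (Nat.factorial (a i) : ℂ)

/-- The variety in `ℂⁿ` of an ideal of `Π`. -/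
def variety {n : ℕ} (I : Ideal (Poly n)) : Set (Fin n → ℂ) :=
  {θ | ∀ q ∈ I, eval θ q = 0}

/-- The kernel of an ideal `I`: the span of all exponential polynomials `e_α p`, with `α` in the
variety of `I` and `p ∈ Π`, that are orthogonal to `I` under the pairing. -/
noncomputable def idealKer {n : ℕ} (I : Ideal (Poly n)) : Submodule ℂ (Series n) :=
  Submodule.span ℂ {g | ∃ α ∈ variety I, ∃ p : Poly n,
    g = expSeries α * toSeries n p ∧ ∀ q ∈ I, pairing q g = 0}

/-! ### The least map and interpolation -/

/-- The least map `f ↦ f↓`: the nonzero homogeneous component of `f` of lowest degree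
(and `0↓ = 0`), as a polynomial. -/
noncomputable def least {n : ℕ} (f : Series n) : Poly n :=
  MvPowerSeries.truncTotal (f.order.toNat + 1)
    (MvPowerSeries.homogeneousComponent f.order.toNat f)

/-- `Exp(σ)`, the span of the exponentials `e_α`, `α ∈ σ`. -/
noncomputable def expSpace {n : ℕ} (σ : Set (Fin n → ℝ)) : Submodule ℂ (Series n) :=
  Submodule.span ℂ ((fun α : Fin n → ℝ => expSeries fun i => (α i : ℂ)) '' σ)

/-- `Π(σ)`, the span of the polynomials `f↓`, `f ∈ Exp(σ)`. -/
noncomputable def leastSpace {n : ℕ} (σ : Set (Fin n → ℝ)) : Submodule ℂ (Poly n) :=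
  Submodule.span ℂ (least '' (expSpace σ : Set (Series n)))

/-- `σ` is correct for `P`: the restriction map `P → ℂ^σ` is invertible. -/
def IsCorrect {n : ℕ} (σ : Set (Fin n → ℝ)) (P : Submodule ℂ (Poly n)) : Prop :=
  Function.Bijective fun (p : P) (v : σ) => eval (fun i => ((v : Fin n → ℝ) i : ℂ)) (p : Poly n)

/-! ### Linear forms and the matroid of `X` -/

/-- The linear form `p_x : t ↦ x · t`. -/
noncomputable def linForm {n : ℕ} (x : Fin n → ℝ) : Poly n :=
  ∑ i, C (x i : ℂ) * MvPolynomial.X i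

/-- `p_Y = ∏_{y ∈ Y} p_y`. -/
noncomputable def prodForm {n : ℕ} {ι : Type*} (X : ι → Fin n → ℝ) (Y : Finset ι) : Poly n :=
  ∏ i ∈ Y, linForm (X i)

/-- `B ∈ 𝔹(X)`: the vectors of `B ⊂ X` form a basis of `ℝⁿ`. -/
def IsBasis {n : ℕ} {ι : Type*} (X : ι → Fin n → ℝ) (B : Finset ι) : Prop :=
  LinearIndepOn ℝ X (B : Set ι) ∧ Submodule.span ℝ (X '' (B : Set ι)) = ⊤

/-- `b` is internally active in `B`: it is the last element of `X \ H`, `H = span (B \ b)`. -/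
def InternallyActive {n : ℕ} {ι : Type*} [LinearOrder ι] (X : ι → Fin n → ℝ)
    (B : Finset ι) (b : ι) : Prop :=
  IsGreatest {j | X j ∉ Submodule.span ℝ (X '' (B.erase b : Set ι))} b

/-- `𝔹₋(X)`: the internal bases, i.e. the bases without internally active elements. -/
def internalBases {n : ℕ} {ι : Type*} [LinearOrder ι] (X : ι → Fin n → ℝ) : Set (Finset ι) :=
  {B | IsBasis X B ∧ ∀ b ∈ B, ¬ InternallyActive X B b}

/-- `L₋(X)`: the barely long subsets of `X`, which meet every internal basis. -/
def barelyLong {n : ℕ} {ι : Type*} [LinearOrder ι] (X : ι → Fin n → ℝ) : Set (Finset ι) :=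
  {Y | ∀ B ∈ internalBases X, (Y ∩ B).Nonempty}

/-- `H ∈ 𝓕(X)`: a linear hyperplane spanned by the vectors of `X` that it contains. -/
def IsFacetHyperplane {n : ℕ} {ι : Type*} (X : ι → Fin n → ℝ)
    (H : Submodule ℝ (Fin n → ℝ)) : Prop :=
  Module.finrank ℝ H + 1 = n ∧ Submodule.span ℝ (Set.range X ∩ (H : Set (Fin n → ℝ))) = H

/-- `m(H) = #(X \ H)`, counted with multiplicity. -/
noncomputable def facetMult {n : ℕ} {ι : Type*} (X : ι → Fin n → ℝ)
    (H : Submodule ℝ (Fin n → ℝ)) : ℕ :=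
  {i | X i ∉ H}.ncard

/-! ### Spaces and ideals -/

/-- The central space `𝓟(A)` of the sub-multiset `A` of `X`: the span of `p_Y` over the short
subsets `Y` of `A`, i.e. those with `rank (A \ Y) = n`. -/
noncomputable def centralP {n : ℕ} {ι : Type*} [DecidableEq ι] (X : ι → Fin n → ℝ)
    (A : Finset ι) : Submodule ℂ (Poly n) :=
  Submodule.span ℂ {p | ∃ Y ⊆ A,
    Submodule.span ℝ (X '' ((A \ Y : Finset ι) : Set ι)) = ⊤ ∧ p = prodForm X Y}

/-- The internal space `𝓟₋(X) = ⋂_{x ∈ X} 𝓟(X \ x)`. -/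
noncomputable def internalP {n : ℕ} {ι : Type*} [Fintype ι] [DecidableEq ι]
    (X : ι → Fin n → ℝ) : Submodule ℂ (Poly n) :=
  ⨅ x : ι, centralP X (Finset.univ.erase x)

/-- The ideal `𝓘₋(X)`, generated by `p_η^{m(H) - 1}` for the facet hyperplanes `H` and their
nonzero normals `η`.  (If `X` spans `ℝⁿ` then `m(H) ≥ 1`, and the normals of `H` are nonzero
multiples of each other.) -/
noncomputable def internalI {n : ℕ} {ι : Type*} (X : ι → Fin n → ℝ) : Ideal (Poly n) :=
  Ideal.span {q | ∃ (H : Submodule ℝ (Fin n → ℝ)) (η : Fin n → ℝ), IsFacetHyperplane X H ∧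
    η ≠ 0 ∧ (∀ h ∈ H, η ⬝ᵥ h = 0) ∧ q = linForm η ^ (facetMult X H - 1)}

/-- The ideal `𝓙₋(X)`, generated by the `p_Y` with `Y` barely long. -/
noncomputable def internalJ {n : ℕ} {ι : Type*} [LinearOrder ι] (X : ι → Fin n → ℝ) :
    Ideal (Poly n) :=
  Ideal.span (prodForm X '' barelyLong X)

/-- The space `𝓓₋(X)` of the polynomials `f` with `p_Y(D) f = 0` for every barely long `Y`. -/
noncomputable def internalD {n : ℕ} {ι : Type*} [LinearOrder ι] (X : ι → Fin n → ℝ) :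
    Submodule ℂ (Poly n) where
  carrier := {f | ∀ Y ∈ barelyLong X, diffOp (prodForm X Y) (toSeries n f) = 0}
  add_mem' hf hg Y hY := by rw [map_add, map_add, hf Y hY, hg Y hY, add_zero]
  zero_mem' Y _ := by rw [map_zero, map_zero]
  smul_mem' c f hf Y hY := by rw [map_smul, map_smul, hf Y hY, smul_zero]

/-! ### The hyperplane arrangement -/

/-- `λ` is generic: any `n + 1` of the hyperplanes `x · t = λ_x`, `x ∈ X`, have no common point. -/
def IsGeneric {n : ℕ} {ι : Type*} (X : ι → Fin n → ℝ) (lam : ι → ℝ) : Prop :=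
  ∀ S : Finset ι, S.card = n + 1 → ¬ ∃ t : Fin n → ℝ, ∀ i ∈ S, X i ⬝ᵥ t = lam i

/-- `V₋(X, λ)`: the vertices `v_B` of the arrangement that come from internal bases `B`. -/
def internalVertices {n : ℕ} {ι : Type*} [LinearOrder ι] (X : ι → Fin n → ℝ) (lam : ι → ℝ) :
    Set (Fin n → ℝ) :=
  {v | ∃ B ∈ internalBases X, ∀ i ∈ B, X i ⬝ᵥ v = lam i}

end ZonotopalAlgebra

open ZonotopalAlgebra

/-!
Both `𝒫₋(X)` and `𝒟₋(X)` are orthogonal complements of ideals under the pairing: `𝒟₋ = 𝒥₋^⊥` by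
definition, and `𝒫₋ = ℐ₋^⊥`, which means that `f ∈ 𝒫₋` if and only if `D_η ^ (m(H) - 1) f = 0` for
every facet hyperplane `H` with normal `η`.  Such conditions pass to deletions and contractions,
where after contracting a set `Z` one only keeps track of `f` on the flat
`{t | x · t = λ_x, x ∈ Z}`.  Induction on `X` then shows, for `λ = 0`, that the central space is cut
out by the conditions with `m(H)` in place of `m(H) - 1`, whence `𝒫₋ = ℐ₋^⊥`, and, for generic `λ`,
that an element of `𝒫₋` that vanishes on `V₋` is zero.  Thus `dim 𝒫₋ ≤ #V₋ = #𝔹₋`.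

If `Y` misses an internal basis `B`, then subtracting from each factor `p_y` suitable multiples of
`p_b`, for earlier vectors `b ∈ B` that are coloops of `X \ Y`, moves the product `p_Y` into `𝒫₋`
and changes it only by products of smaller weight.  Hence `𝒫₋ + 𝒥₋ = Π`, so that `dim 𝒟₋ ≤ dim 𝒫₋`.

If `Y` meets every internal basis, then `p_Y` is the leading form of `∏ (p_y - λ_y)`, which vanishes
on `V₋`, so that `Π(V₋) ⊆ 𝒟₋`.  The restriction of `Π(V₋)` to `V₋` is onto, because `f↓` pairs
nontrivially with the conjugate of `f`.  So all of `#V₋ ≤ dim 𝒟₋ ≤ dim 𝒫₋ ≤ #V₋` are equalities.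
-/

namespace ZonotopalAlgebra

open MvPolynomial

/-! ### The pairing -/

section Pairing

variable {n : ℕ}

/-- The multi-factorial `a! = ∏ aᵢ!`: the pairing is `⟨t ^ a, f⟩ = a! [t ^ a] f`. -/
noncomputable def multiFactorial (a : Fin n →₀ ℕ) : ℂ :=
  ∏ i, ((a i).factorial : ℂ)

theorem multiFactorial_ne_zero (a : Fin n →₀ ℕ) : multiFactorial a ≠ 0 :=
  Finset.prod_ne_zero_iff.2 fun _ _ => Nat.cast_ne_zero.2 (Nat.factorial_ne_zero _)

theorem multiFactorial_zero : multiFactorial (0 : Fin n →₀ ℕ) = 1 := by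
  simp [multiFactorial]

theorem multiFactorial_add_single (a : Fin n →₀ ℕ) (i : Fin n) :
    multiFactorial (a + Finsupp.single i 1) = multiFactorial a * (a i + 1) := by
  have factorial_add (j : Fin n) : (((a + Finsupp.single i 1 : Fin n →₀ ℕ) j).factorial : ℂ) =
      (a j).factorial * if j = i then (a i + 1 : ℂ) else 1 := by
    by_cases h : j = i
    · subst h
      simp [Nat.factorial_succ, mul_comm]
    · simp [h]
  simp only [multiFactorial, factorial_add, Finset.prod_mul_distrib, Finset.prod_ite_eq',
    Finset.mem_univ, if_true]

/-- `∂/∂tᵢ` as an endomorphism of the space of power series. -/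
noncomputable def seriesDeriv (i : Fin n) : Module.End ℂ (Series n) :=
  (MvPowerSeries.pderiv ℂ i : Series n →ₗ[ℂ] Series n)

theorem multiFactorial_mul_coeff_seriesDeriv (i : Fin n) (b : Fin n →₀ ℕ) (f : Series n) :
    multiFactorial b * MvPowerSeries.coeff b (seriesDeriv i f) =
      multiFactorial (b + Finsupp.single i 1) *
        MvPowerSeries.coeff (b + Finsupp.single i 1) f := by
  have coeff_deriv : MvPowerSeries.coeff b (seriesDeriv i f) =
      MvPowerSeries.coeff (b + Finsupp.single i 1) f * (b i + 1) :=
    MvPowerSeries.coeff_pderiv _ _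
  rw [coeff_deriv, multiFactorial_add_single]
  ring

theorem multiFactorial_mul_coeff_seriesDeriv_pow (i : Fin n) (k : ℕ) (b : Fin n →₀ ℕ)
    (f : Series n) :
    multiFactorial b * MvPowerSeries.coeff b ((seriesDeriv i ^ k) f) =
      multiFactorial (b + Finsupp.single i k) *
        MvPowerSeries.coeff (b + Finsupp.single i k) f := by
  induction k generalizing b with
  | zero => simp
  | succ k ih =>
    rw [pow_succ', Module.End.mul_apply, multiFactorial_mul_coeff_seriesDeriv, ih, add_assoc,
      ← Finsupp.single_add, add_comm 1 k]

theorem multiFactorial_mul_coeff_prod_seriesDeriv (a : Fin n →₀ ℕ) (l : List (Fin n))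
    (b : Fin n →₀ ℕ) (f : Series n) :
    multiFactorial b * MvPowerSeries.coeff b ((l.map fun i => seriesDeriv i ^ a i).prod f) =
      multiFactorial (b + (l.map fun i => Finsupp.single i (a i)).sum) *
        MvPowerSeries.coeff (b + (l.map fun i => Finsupp.single i (a i)).sum) f := by
  induction l generalizing b with
  | nil => simp
  | cons i l ih =>
    rw [List.map_cons, List.prod_cons, Module.End.mul_apply,
      multiFactorial_mul_coeff_seriesDeriv_pow, ih, List.map_cons, List.sum_cons, add_assoc]

theorem multiFactorial_mul_coeff_partialPow (a b : Fin n →₀ ℕ) (f : Series n) :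
    multiFactorial b * MvPowerSeries.coeff b (partialPow a f) =
      multiFactorial (b + a) * MvPowerSeries.coeff (b + a) f := by
  have sum_single : ((List.finRange n).map fun i => Finsupp.single i (a i)).sum = a := by
    rw [← List.ofFn_eq_map, List.sum_ofFn, Finsupp.univ_sum_single]
  rw [partialPow, List.ofFn_eq_map]
  have coeff_prod := multiFactorial_mul_coeff_prod_seriesDeriv a (List.finRange n) b f
  rwa [sum_single] at coeff_prod

/-- The pairing `⟨p, f⟩` as a bilinear map; see `pairing_eq_seriesPairing`. -/
noncomputable def seriesPairing : Poly n →ₗ[ℂ] Module.Dual ℂ (Series n) :=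
  (basisMonomials (Fin n) ℂ).constr ℂ fun a => multiFactorial a • MvPowerSeries.coeff a

theorem seriesPairing_monomial (a : Fin n →₀ ℕ) (c : ℂ) (f : Series n) :
    seriesPairing (monomial a c) f = c * (multiFactorial a * MvPowerSeries.coeff a f) := by
  have monomial_eq : monomial a c = c • (basisMonomials (Fin n) ℂ a : Poly n) := by
    simp [coe_basisMonomials, smul_monomial]
  rw [monomial_eq, map_smul, seriesPairing, Module.Basis.constr_basis]
  rfl

theorem multiFactorial_mul_coeff_diffOp (p : Poly n) (b : Fin n →₀ ℕ) (f : Series n) :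
    multiFactorial b * MvPowerSeries.coeff b (diffOp p f) =
      seriesPairing (monomial b 1 * p) f := by
  conv_rhs => rw [← support_sum_monomial_coeff p]
  rw [Finset.mul_sum, map_sum, LinearMap.sum_apply, diffOp, LinearMap.sum_apply, map_sum,
    Finset.mul_sum]
  refine Finset.sum_congr rfl fun a _ => ?_
  rw [monomial_mul, seriesPairing_monomial, LinearMap.smul_apply, map_smul, smul_eq_mul,
    mul_left_comm, multiFactorial_mul_coeff_partialPow, one_mul]

theorem pairing_eq_seriesPairing (p : Poly n) : pairing p = seriesPairing p := by
  ext f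
  simpa [multiFactorial_zero, pairing] using multiFactorial_mul_coeff_diffOp p 0 f

theorem diffOp_eq_zero_iff {p : Poly n} {f : Series n} :
    diffOp p f = 0 ↔ ∀ q, seriesPairing (q * p) f = 0 := by
  constructor
  · intro h q
    induction q using MvPolynomial.induction_on' with
    | monomial a c =>
      have coeff_eq := multiFactorial_mul_coeff_diffOp p a f
      rw [h, map_zero, mul_zero] at coeff_eq
      have monomial_eq : (monomial a c : Poly n) = c • monomial a 1 := by
        rw [smul_monomial, smul_eq_mul, mul_one]
      rw [monomial_eq, smul_mul_assoc, map_smul, LinearMap.smul_apply, ← coeff_eq, smul_zero]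
    | add q₁ q₂ h₁ h₂ => rw [add_mul, map_add, LinearMap.add_apply, h₁, h₂, add_zero]
  · intro h
    ext a
    have coeff_eq := multiFactorial_mul_coeff_diffOp p a f
    rw [h] at coeff_eq
    rw [map_zero]
    exact (mul_eq_zero.1 coeff_eq).resolve_left (multiFactorial_ne_zero a)

theorem coeff_expSeries (α : Fin n → ℂ) (a : Fin n →₀ ℕ) :
    MvPowerSeries.coeff a (expSeries α) = ∏ i, α i ^ a i / ((a i).factorial : ℂ) :=
  rfl

theorem seriesPairing_expSeries (p : Poly n) (α : Fin n → ℂ) :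
    seriesPairing p (expSeries α) = eval α p := by
  induction p using MvPolynomial.induction_on' with
  | add p q hp hq => rw [map_add, LinearMap.add_apply, hp, hq, map_add]
  | monomial a c =>
    rw [seriesPairing_monomial, eval_monomial, Finsupp.prod_fintype _ _ (by simp),
      coeff_expSeries, multiFactorial, ← Finset.prod_mul_distrib]
    congr 1
    refine Finset.prod_congr rfl fun i _ => mul_div_cancel₀ _ ?_
    exact Nat.cast_ne_zero.2 (Nat.factorial_ne_zero _)

/-- The restriction of the pairing to polynomials. -/
noncomputable def polyPairing : LinearMap.BilinForm ℂ (Poly n) :=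
  seriesPairing.compl₂ (toSeries n)

theorem coeff_toSeries (a : Fin n →₀ ℕ) (p : Poly n) :
    MvPowerSeries.coeff a (toSeries n p) = coeff a p :=
  coeff_coe p a

theorem polyPairing_monomial (a : Fin n →₀ ℕ) (c : ℂ) (f : Poly n) :
    polyPairing (monomial a c) f = c * (multiFactorial a * coeff a f) := by
  rw [polyPairing, LinearMap.compl₂_apply, seriesPairing_monomial, coeff_toSeries]

theorem polyPairing_comm (p q : Poly n) : polyPairing p q = polyPairing q p := by
  suffices polyPairing = (polyPairing : LinearMap.BilinForm ℂ (Poly n)).flip from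
    LinearMap.congr_fun₂ this p q
  refine (basisMonomials (Fin n) ℂ).ext fun a => (basisMonomials (Fin n) ℂ).ext fun b => ?_
  rw [LinearMap.BilinForm.flip_apply]
  simp only [coe_basisMonomials, polyPairing_monomial, coeff_monomial]
  by_cases h : a = b
  · rw [h]
  · simp only [if_neg h, if_neg (Ne.symm h), mul_zero]

theorem eq_zero_of_polyPairing_eq_zero {f : Poly n} (h : ∀ q, polyPairing q f = 0) : f = 0 := by
  ext a
  have coeff_eq := h (monomial a 1)
  rw [polyPairing_monomial, one_mul] at coeff_eq
  exact (mul_eq_zero.1 coeff_eq).resolve_left (multiFactorial_ne_zero a)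

end Pairing

section DirDeriv

variable {n : ℕ}

/-- The derivative in the direction `η`, which is `p_η(D)`. -/
noncomputable def dirDeriv (η : Fin n → ℝ) : Derivation ℂ (Poly n) (Poly n) :=
  mkDerivation ℂ fun i => C (η i : ℂ)

theorem dirDeriv_X (η : Fin n → ℝ) (i : Fin n) :
    dirDeriv η (X i : Poly n) = C (η i : ℂ) :=
  mkDerivation_X _ _ _

theorem dirDeriv_C (η : Fin n → ℝ) (c : ℂ) : dirDeriv η (C c : Poly n) = 0 :=
  Derivation.map_algebraMap _ c

theorem dirDeriv_eq_sum_pderiv (η : Fin n → ℝ) (f : Poly n) :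
    dirDeriv η f = ∑ i, (η i : ℂ) • pderiv i f := by
  induction f using MvPolynomial.induction_on with
  | C c => simp
  | add p q hp hq => simp only [map_add, hp, hq, smul_add, Finset.sum_add_distrib]
  | mul_X p j hp =>
    simp only [Derivation.leibniz, dirDeriv_X, hp, pderiv_X, smul_add, Finset.sum_add_distrib,
      Finset.smul_sum]
    congr 1
    · simp [Pi.single_apply, smul_eq_C_mul, mul_comm]
    · exact Finset.sum_congr rfl fun i _ => smul_comm _ _ _

theorem dirDeriv_linForm (η x : Fin n → ℝ) :
    dirDeriv η (linForm x) = C ((η ⬝ᵥ x : ℝ) : ℂ) := by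
  rw [linForm, map_sum, dotProduct, Complex.ofReal_sum, map_sum]
  refine Finset.sum_congr rfl fun i _ => ?_
  rw [Derivation.leibniz, dirDeriv_C, dirDeriv_X, smul_zero, add_zero, smul_eq_mul, ← map_mul,
    Complex.ofReal_mul, mul_comm]

theorem dirDeriv_iterate_smul (η : Fin n → ℝ) (k : ℕ) (c : ℂ) (f : Poly n) :
    (dirDeriv η)^[k] (c • f) = c • (dirDeriv η)^[k] f :=
  Function.Commute.iterate_left (g := (c • ·)) ((dirDeriv η).map_smul c) k f

theorem dirDeriv_iterate_mul (η : Fin n → ℝ) {l : Poly n} {c : ℂ} (hl : dirDeriv η l = C c)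
    (f : Poly n) (k : ℕ) :
    (dirDeriv η)^[k] (l * f) =
      l * (dirDeriv η)^[k] f + C (k * c) * (dirDeriv η)^[k - 1] f := by
  induction k with
  | zero => simp
  | succ k ih =>
    have deriv_pred : C (k * c) * dirDeriv η ((dirDeriv η)^[k - 1] f) =
        C (k * c) * (dirDeriv η)^[k] f := by
      rcases k with _ | k
      · simp
      · rw [← Function.iterate_succ_apply' (dirDeriv η), Nat.add_sub_cancel]
    rw [Function.iterate_succ_apply', ih, map_add, Derivation.leibniz, Derivation.leibniz, hl,
      dirDeriv_C, Function.iterate_succ_apply', Nat.add_sub_cancel]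
    simp only [smul_eq_mul, deriv_pred, Nat.cast_succ, add_mul, one_mul, map_add]
    ring

theorem dirDeriv_iterate_eq_zero_of_le {η : Fin n → ℝ} {f : Poly n} {k m : ℕ} (hkm : k ≤ m)
    (hf : (dirDeriv η)^[k] f = 0) : (dirDeriv η)^[m] f = 0 := by
  rw [← Nat.sub_add_cancel hkm, Function.iterate_add_apply, hf]
  exact Function.iterate_fixed (map_zero _) _

theorem exists_dirDeriv_iterate_eq_zero (η : Fin n → ℝ) (f : Poly n) :
    ∃ k, (dirDeriv η)^[k] f = 0 := by
  induction f using MvPolynomial.induction_on with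
  | C c => exact ⟨1, dirDeriv_C η c⟩
  | add p q hp hq =>
    obtain ⟨k, hk⟩ := hp
    obtain ⟨m, hm⟩ := hq
    exact ⟨max k m, by rw [iterate_map_add, dirDeriv_iterate_eq_zero_of_le (le_max_left k m) hk,
      dirDeriv_iterate_eq_zero_of_le (le_max_right k m) hm, add_zero]⟩
  | mul_X p i hp =>
    obtain ⟨k, hk⟩ := hp
    refine ⟨k + 1, ?_⟩
    rw [mul_comm, dirDeriv_iterate_mul η (dirDeriv_X η i),
      dirDeriv_iterate_eq_zero_of_le k.le_succ hk, Nat.add_sub_cancel, hk, mul_zero, mul_zero,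
      add_zero]

theorem polyPairing_X_mul (i : Fin n) (q f : Poly n) :
    polyPairing (X i * q) f = polyPairing q (pderiv i f) := by
  induction q using MvPolynomial.induction_on' with
  | add p q hp hq => rw [mul_add, map_add, map_add, LinearMap.add_apply, hp, hq,
      LinearMap.add_apply]
  | monomial a c =>
    rw [X, monomial_mul, polyPairing_monomial, polyPairing_monomial, coeff_pderiv,
      add_comm (Finsupp.single i 1) a, multiFactorial_add_single]
    ring

theorem polyPairing_linForm_mul (η : Fin n → ℝ) (q f : Poly n) :
    polyPairing (linForm η * q) f = polyPairing q (dirDeriv η f) := by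
  rw [linForm, Finset.sum_mul, dirDeriv_eq_sum_pderiv, map_sum, map_sum, LinearMap.sum_apply]
  refine Finset.sum_congr rfl fun i _ => ?_
  rw [mul_assoc, C_mul', map_smul, LinearMap.smul_apply, polyPairing_X_mul, map_smul]

theorem polyPairing_mul_linForm_pow (η : Fin n → ℝ) (k : ℕ) (q f : Poly n) :
    polyPairing (q * linForm η ^ k) f = polyPairing q ((dirDeriv η)^[k] f) := by
  induction k generalizing f with
  | zero => simp
  | succ k ih =>
    rw [pow_succ, ← mul_assoc, mul_comm _ (linForm η), polyPairing_linForm_mul, ih,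
      Function.iterate_succ_apply]

theorem dirDeriv_iterate_eq_zero_iff {η : Fin n → ℝ} {k : ℕ} {f : Poly n} :
    (dirDeriv η)^[k] f = 0 ↔ ∀ q, polyPairing (q * linForm η ^ k) f = 0 := by
  simp only [polyPairing_mul_linForm_pow]
  exact ⟨fun h q => by rw [h, map_zero], eq_zero_of_polyPairing_eq_zero⟩

end DirDeriv

/-! ### Orthogonal complements of ideals -/

section IdealPerp

variable {n : ℕ}

/-- `I^⊥`: the polynomials that are orthogonal to the ideal `I` under the pairing. -/
noncomputable def idealPerp (I : Ideal (Poly n)) : Submodule ℂ (Poly n) :=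
  (I.restrictScalars ℂ).orthogonalBilin polyPairing

theorem mem_idealPerp_span {S : Set (Poly n)} {f : Poly n} :
    f ∈ idealPerp (Ideal.span S) ↔ ∀ p ∈ S, ∀ q, polyPairing (q * p) f = 0 := by
  refine ⟨fun h p hp q => h _ (Ideal.mul_mem_left _ _ (Ideal.subset_span hp)), fun h q hq => ?_⟩
  have orthogonal_multiples : ∀ r, polyPairing (r * q) f = 0 := by
    induction hq using Submodule.span_induction with
    | mem p hp => exact h p hp
    | zero => simp
    | add p q _ _ hp hq => intro r; rw [mul_add, map_add, LinearMap.add_apply, hp, hq, add_zero]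
    | smul a p _ hp => intro r; rw [smul_eq_mul, ← mul_assoc]; exact hp _
  simpa using orthogonal_multiples 1

theorem idealPerp_top : idealPerp (⊤ : Ideal (Poly n)) = ⊥ :=
  (Submodule.eq_bot_iff _).2 fun _ hf =>
    eq_zero_of_polyPairing_eq_zero fun q => hf q Submodule.mem_top

theorem polyPairing_injective_of_sup_eq_top {P : Submodule ℂ (Poly n)} {I : Ideal (Poly n)}
    (h : P ⊔ I.restrictScalars ℂ = ⊤) :
    Function.Injective (polyPairing.domRestrict₁₂ (idealPerp I) P) := by
  refine (injective_iff_map_eq_zero _).2 fun f hf => Subtype.ext ?_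
  refine eq_zero_of_polyPairing_eq_zero fun q => ?_
  obtain ⟨p, hp, r, hr, rfl⟩ := Submodule.mem_sup.1 (h ▸ Submodule.mem_top : q ∈ P ⊔ _)
  rw [map_add, LinearMap.add_apply, f.2 r hr, add_zero, polyPairing_comm]
  exact LinearMap.congr_fun hf ⟨p, hp⟩

theorem disjoint_of_polyPairing_surjective {P : Submodule ℂ (Poly n)} {I : Ideal (Poly n)}
    (h : Function.Surjective (polyPairing.domRestrict₁₂ (idealPerp I) P)) :
    Disjoint P (I.restrictScalars ℂ) := by
  refine Submodule.disjoint_def.2 fun p hpP hpI => ?_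
  suffices (⟨p, hpP⟩ : P) = 0 from congrArg Subtype.val this
  refine (Module.forall_dual_apply_eq_zero_iff ℂ _).1 fun φ => ?_
  obtain ⟨f, rfl⟩ := h φ
  rw [LinearMap.domRestrict₁₂_apply, polyPairing_comm]
  exact f.2 p hpI

theorem eq_top_of_variety_eq_empty {I : Ideal (Poly n)} (hI : variety I = ∅) : I = ⊤ := by
  have zeroLocus_eq : zeroLocus ℂ I = ∅ := by
    rw [← hI]
    ext θ
    simp [variety, mem_zeroLocus_iff]
  rw [← Ideal.radical_eq_top, ← vanishingIdeal_zeroLocus_eq_radical (K := ℂ), zeroLocus_eq,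
    vanishingIdeal_empty]

theorem expSeries_zero : expSeries (0 : Fin n → ℂ) = 1 := by
  ext a
  rw [MvPowerSeries.coeff_one, coeff_expSeries]
  split_ifs with h
  · simp [h]
  · obtain ⟨i, hi⟩ := Finsupp.ne_iff.1 h
    refine Finset.prod_eq_zero (Finset.mem_univ i) ?_
    rw [Pi.zero_apply, zero_pow hi, zero_div]

theorem map_idealPerp_eq_idealKer {I : Ideal (Poly n)} (hI : variety I ⊆ {0}) :
    (idealPerp I).map (toSeries n) = idealKer I := by
  apply le_antisymm
  · rcases Set.subset_singleton_iff_eq.1 hI with hempty | hzero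
    · rw [eq_top_of_variety_eq_empty hempty, idealPerp_top, Submodule.map_bot]
      exact bot_le
    · rintro _ ⟨p, hp, rfl⟩
      refine Submodule.subset_span ⟨0, hzero ▸ rfl, p, by rw [expSeries_zero, one_mul], ?_⟩
      exact fun q hq => (LinearMap.congr_fun (pairing_eq_seriesPairing q) _).trans (hp q hq)
  · refine Submodule.span_le.2 ?_
    rintro _ ⟨α, hα, p, rfl, hp⟩
    obtain rfl : α = 0 := hI hα
    rw [expSeries_zero, one_mul] at hp ⊢
    refine ⟨p, fun q hq => ?_, rfl⟩
    exact (LinearMap.congr_fun (pairing_eq_seriesPairing q) _).symm.trans (hp q hq)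

theorem internalD_eq_idealPerp {ι : Type*} [LinearOrder ι] (X : ι → Fin n → ℝ) :
    internalD X = idealPerp (internalJ X) := by
  ext f
  rw [internalJ, mem_idealPerp_span, Set.forall_mem_image]
  exact forall₂_congr fun Y _ => diffOp_eq_zero_iff

theorem mem_idealPerp_internalI {ι : Type*} {X : ι → Fin n → ℝ} {f : Poly n} :
    f ∈ idealPerp (internalI X) ↔ ∀ (H : Submodule ℝ (Fin n → ℝ)) (η : Fin n → ℝ),
      IsFacetHyperplane X H → η ≠ 0 → (∀ h ∈ H, η ⬝ᵥ h = 0) →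
        (dirDeriv η)^[facetMult X H - 1] f = 0 := by
  simp only [internalI, mem_idealPerp_span, dirDeriv_iterate_eq_zero_iff]
  constructor
  · exact fun h H η hH hη hn => h _ ⟨H, η, hH, hη, hn, rfl⟩
  · rintro h _ ⟨H, η, hH, hη, hn, rfl⟩
    exact h H η hH hη hn

end IdealPerp

section LinForm

variable {n : ℕ}

/-- The map `x ↦ p_x` as a linear map. -/
noncomputable def linFormHom : (Fin n → ℝ) →ₗ[ℝ] Poly n where
  toFun := linForm
  map_add' x y := by
    simp only [linForm, Pi.add_apply, Complex.ofReal_add, map_add, add_mul,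
      Finset.sum_add_distrib]
  map_smul' c x := by
    simp only [linForm, Pi.smul_apply, smul_eq_mul, Complex.ofReal_mul, map_mul, Finset.smul_sum,
      RingHom.id_apply, mul_assoc, ← smul_eq_C_mul (_ * _) (c : ℂ), Complex.coe_smul]

theorem linForm_single (i : Fin n) : linForm (Pi.single i 1) = (X i : Poly n) := by
  rw [linForm, Finset.sum_eq_single i (fun j _ hj => by simp [Pi.single_eq_of_ne hj]) (by simp)]
  simp

theorem linForm_mem_span_of_mem_span {s : Set (Fin n → ℝ)} {x : Fin n → ℝ}
    (hx : x ∈ Submodule.span ℝ s) : linForm x ∈ Submodule.span ℂ (linForm '' s) :=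
  Submodule.span_le_restrictScalars ℝ ℂ _
    (Submodule.map_span (linFormHom (n := n)) s ▸ Submodule.mem_map_of_mem hx)

/-- The inclusion `ℝⁿ → ℂⁿ`. -/
def complexPoint (t : Fin n → ℝ) : Fin n → ℂ := fun i => (t i : ℂ)

theorem eval_linForm (x t : Fin n → ℝ) :
    eval (complexPoint t) (linForm x) = ((x ⬝ᵥ t : ℝ) : ℂ) := by
  simp [linForm, complexPoint, dotProduct]

theorem dirDeriv_iterate_prod_linForm_eq_zero {κ : Type*} (η : Fin n → ℝ) (x : κ → Fin n → ℝ)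
    (Y : Finset κ) {k : ℕ} (h : (Y.filter fun y => η ⬝ᵥ x y ≠ 0).card < k) :
    (dirDeriv η)^[k] (∏ y ∈ Y, linForm (x y)) = 0 := by
  classical
  induction Y using Finset.induction_on generalizing k with
  | empty =>
    refine dirDeriv_iterate_eq_zero_of_le (Nat.one_le_of_lt h) ?_
    rw [Finset.prod_empty, ← C_1]
    exact dirDeriv_C η 1
  | insert a Y ha ih =>
    rw [Finset.prod_insert ha, dirDeriv_iterate_mul η (dirDeriv_linForm η (x a))]
    rw [Finset.filter_insert] at h
    split_ifs at h with h0
    · rw [Finset.card_insert_of_notMem (by simp [ha])] at h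
      rw [ih (by omega), ih (by omega), mul_zero, mul_zero, add_zero]
    · rw [ih h, not_not.1 h0]
      simp

/-- The affine form `t ↦ x · t - c`. -/
noncomputable def affForm (x : Fin n → ℝ) (c : ℝ) : Poly n := linForm x - C (c : ℂ)

theorem affForm_zero (x : Fin n → ℝ) : affForm x 0 = linForm x := by
  simp [affForm]

theorem eval_affForm (x : Fin n → ℝ) (c : ℝ) (t : Fin n → ℝ) :
    eval (complexPoint t) (affForm x c) = ((x ⬝ᵥ t - c : ℝ) : ℂ) := by
  rw [affForm, map_sub, eval_linForm, eval_C, Complex.ofReal_sub]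

theorem dirDeriv_affForm (η x : Fin n → ℝ) (c : ℝ) :
    dirDeriv η (affForm x c) = C ((η ⬝ᵥ x : ℝ) : ℂ) := by
  rw [affForm, map_sub, dirDeriv_linForm, dirDeriv_C, sub_zero]

end LinForm

/-! ### Polynomials vanishing on sets of real points -/

section RealVanishingIdeal

variable {n : ℕ}

/-- The ideal of the polynomials that vanish on the set `T` of real points.  Working modulo this
ideal amounts to restricting polynomials to `T`. -/
noncomputable def realVanishingIdeal (T : Set (Fin n → ℝ)) : Ideal (Poly n) :=
  vanishingIdeal ℂ (complexPoint '' T)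

theorem mem_realVanishingIdeal {T : Set (Fin n → ℝ)} {f : Poly n} :
    f ∈ realVanishingIdeal T ↔ ∀ t ∈ T, eval (complexPoint t) f = 0 :=
  Set.forall_mem_image

theorem realVanishingIdeal_anti {S T : Set (Fin n → ℝ)} (h : S ⊆ T) :
    realVanishingIdeal T ≤ realVanishingIdeal S :=
  vanishingIdeal_anti_mono (Set.image_mono h)

theorem realVanishingIdeal_univ : realVanishingIdeal (Set.univ : Set (Fin n → ℝ)) = ⊥ := by
  refine (Submodule.eq_bot_iff _).2 fun f hf => ?_
  refine MvPolynomial.funext_set (fun _ : Fin n => Set.range ((↑) : ℝ → ℂ))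
    (fun _ => Set.infinite_range_of_injective Complex.ofReal_injective) fun x hx => ?_
  choose t ht using fun i => hx i (Set.mem_univ i)
  rw [← show complexPoint t = x from funext ht, map_zero]
  exact mem_realVanishingIdeal.1 hf t (Set.mem_univ _)

/-- The restriction of a polynomial to the line through `t` in the direction `u`. -/
noncomputable def lineHom (t u : Fin n → ℝ) : Poly n →ₐ[ℂ] Polynomial ℂ :=
  aeval fun i => Polynomial.C (t i : ℂ) + Polynomial.C (u i : ℂ) * Polynomial.X

theorem lineHom_C (t u : Fin n → ℝ) (c : ℂ) : lineHom t u (C c) = Polynomial.C c :=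
  (lineHom t u).commutes c

theorem lineHom_X (t u : Fin n → ℝ) (i : Fin n) :
    lineHom t u (X i) = Polynomial.C (t i : ℂ) + Polynomial.C (u i : ℂ) * Polynomial.X :=
  aeval_X _ _

theorem eval_lineHom (t u : Fin n → ℝ) (s : ℝ) (f : Poly n) :
    (lineHom t u f).eval (s : ℂ) = eval (complexPoint (t + s • u)) f := by
  induction f using MvPolynomial.induction_on with
  | C c => rw [lineHom_C, eval_C, Polynomial.eval_C]
  | add p q hp hq => rw [map_add, map_add, Polynomial.eval_add, hp, hq]
  | mul_X p i hp =>
    rw [map_mul, map_mul, Polynomial.eval_mul, hp, lineHom_X, eval_X]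
    simp only [complexPoint, Polynomial.eval_add, Polynomial.eval_C, Polynomial.eval_mul,
      Polynomial.eval_X, Pi.add_apply, Pi.smul_apply, smul_eq_mul, Complex.ofReal_add,
      Complex.ofReal_mul]
    ring

theorem derivative_lineHom (t u : Fin n → ℝ) (f : Poly n) :
    Polynomial.derivative (lineHom t u f) = lineHom t u (dirDeriv u f) := by
  induction f using MvPolynomial.induction_on with
  | C c => rw [dirDeriv_C, map_zero, lineHom_C, Polynomial.derivative_C]
  | add p q hp hq => simp only [map_add, hp, hq]
  | mul_X p i hp =>
    rw [map_mul, Polynomial.derivative_mul, hp, Derivation.leibniz, dirDeriv_X, map_add,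
      smul_eq_mul, smul_eq_mul, map_mul, map_mul, lineHom_X, lineHom_C]
    simp
    ring

theorem eval_eq_zero_of_lineHom_eq_zero {t u : Fin n → ℝ} {f : Poly n} (h : lineHom t u f = 0) :
    eval (complexPoint t) f = 0 := by
  simpa [h] using (eval_lineHom t u 0 f).symm

/-- `T` is a union of lines with direction `u`. -/
def IsUnionOfLines (T : Set (Fin n → ℝ)) (u : Fin n → ℝ) : Prop :=
  ∀ t ∈ T, ∀ s : ℝ, t + s • u ∈ T

theorem IsUnionOfLines.lineHom_eq_zero {T : Set (Fin n → ℝ)} {u : Fin n → ℝ}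
    (hT : IsUnionOfLines T u) {f : Poly n} (hf : f ∈ realVanishingIdeal T) {t : Fin n → ℝ}
    (ht : t ∈ T) : lineHom t u f = 0 := by
  refine Polynomial.eq_zero_of_infinite_isRoot _
    ((Set.infinite_range_of_injective Complex.ofReal_injective).mono ?_)
  rintro _ ⟨s, rfl⟩
  rw [Set.mem_ofPred_eq, Polynomial.IsRoot, eval_lineHom]
  exact mem_realVanishingIdeal.1 hf _ (hT t ht s)

theorem IsUnionOfLines.dirDeriv_mem {T : Set (Fin n → ℝ)} {u : Fin n → ℝ}
    (hT : IsUnionOfLines T u) {f : Poly n} (hf : f ∈ realVanishingIdeal T) :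
    dirDeriv u f ∈ realVanishingIdeal T := by
  refine mem_realVanishingIdeal.2 fun t ht => eval_eq_zero_of_lineHom_eq_zero (u := u) ?_
  rw [← derivative_lineHom, hT.lineHom_eq_zero hf ht, map_zero]

theorem IsUnionOfLines.dirDeriv_iterate_mem {T : Set (Fin n → ℝ)} {u : Fin n → ℝ}
    (hT : IsUnionOfLines T u) {f : Poly n} (hf : f ∈ realVanishingIdeal T) (k : ℕ) :
    (dirDeriv u)^[k] f ∈ realVanishingIdeal T := by
  induction k with
  | zero => exact hf
  | succ k ih =>
    rw [Function.iterate_succ_apply']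
    exact hT.dirDeriv_mem ih

theorem IsUnionOfLines.dirDeriv_iterate_mem_of_le {T : Set (Fin n → ℝ)} {u : Fin n → ℝ}
    (hT : IsUnionOfLines T u) {f : Poly n} {k m : ℕ} (hkm : k ≤ m)
    (hf : (dirDeriv u)^[k] f ∈ realVanishingIdeal T) :
    (dirDeriv u)^[m] f ∈ realVanishingIdeal T := by
  rw [← Nat.sub_add_cancel hkm, Function.iterate_add_apply]
  exact hT.dirDeriv_iterate_mem hf _

theorem IsUnionOfLines.mem_of_affForm_mul_mem {T : Set (Fin n → ℝ)} {x u : Fin n → ℝ}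
    (hT : IsUnionOfLines T u) (hxu : x ⬝ᵥ u ≠ 0) (c : ℝ) {g : Poly n}
    (hg : affForm x c * g ∈ realVanishingIdeal T) : g ∈ realVanishingIdeal T := by
  refine mem_realVanishingIdeal.2 fun t ht => eval_eq_zero_of_lineHom_eq_zero (u := u) ?_
  have lineHom_mul := hT.lineHom_eq_zero hg ht
  rw [map_mul] at lineHom_mul
  refine (mul_eq_zero.1 lineHom_mul).resolve_left fun h => hxu ?_
  have derivative_eq := derivative_lineHom t u (affForm x c)
  rw [h, map_zero, dirDeriv_affForm, lineHom_C, dotProduct_comm] at derivative_eq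
  exact Complex.ofReal_eq_zero.1 (Polynomial.C_eq_zero.1 derivative_eq.symm)

/-- The pullback of polynomials along `t ↦ t - (x · t - c) u`, which for `x · u = 1` is the
projection onto the hyperplane `x · t = c` in the direction `u`. -/
noncomputable def hyperplanePullback (x u : Fin n → ℝ) (c : ℝ) : Poly n →ₐ[ℂ] Poly n :=
  aeval fun i => X i - C (u i : ℂ) * affForm x c

theorem hyperplanePullback_X (x u : Fin n → ℝ) (c : ℝ) (i : Fin n) :
    hyperplanePullback x u c (X i) = X i - C (u i : ℂ) * affForm x c :=
  aeval_X _ _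

theorem hyperplanePullback_C (x u : Fin n → ℝ) (c : ℝ) (a : ℂ) :
    hyperplanePullback x u c (C a) = C a :=
  (hyperplanePullback x u c).commutes a

theorem affForm_dvd_sub_hyperplanePullback (x u : Fin n → ℝ) (c : ℝ) (p : Poly n) :
    affForm x c ∣ p - hyperplanePullback x u c p := by
  induction p using MvPolynomial.induction_on with
  | C a => rw [hyperplanePullback_C, sub_self]; exact dvd_zero _
  | add p q hp hq => rw [map_add, add_sub_add_comm]; exact dvd_add hp hq
  | mul_X p i hp =>
    have sub_eq : p * X i - hyperplanePullback x u c (p * X i) =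
        (p - hyperplanePullback x u c p) * X i +
          affForm x c * (C (u i : ℂ) * hyperplanePullback x u c p) := by
      rw [map_mul, hyperplanePullback_X]
      ring
    exact sub_eq ▸ dvd_add (hp.mul_right _) (dvd_mul_right _ _)

theorem eval_hyperplanePullback (x u : Fin n → ℝ) (c : ℝ) (t : Fin n → ℝ) (p : Poly n) :
    eval (complexPoint t) (hyperplanePullback x u c p) =
      eval (complexPoint (t + (c - x ⬝ᵥ t) • u)) p := by
  induction p using MvPolynomial.induction_on with
  | C a => rw [hyperplanePullback_C, eval_C, eval_C]
  | add p q hp hq => simp only [map_add, hp, hq]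
  | mul_X p i hp =>
    rw [map_mul, map_mul, map_mul, hp, hyperplanePullback_X, map_sub, map_mul, eval_affForm]
    simp only [eval_X, eval_C, complexPoint, Pi.add_apply, Pi.smul_apply, smul_eq_mul,
      Complex.ofReal_add, Complex.ofReal_mul, Complex.ofReal_sub]
    ring

theorem IsUnionOfLines.exists_sub_affForm_mul_mem {T : Set (Fin n → ℝ)} {x u : Fin n → ℝ}
    (hT : IsUnionOfLines T u) (hxu : x ⬝ᵥ u = 1) {c : ℝ} {f : Poly n}
    (hf : f ∈ realVanishingIdeal (T ∩ {t | x ⬝ᵥ t = c})) :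
    ∃ g, f - affForm x c * g ∈ realVanishingIdeal T := by
  obtain ⟨g, hg⟩ := affForm_dvd_sub_hyperplanePullback x u c f
  refine ⟨g, mem_realVanishingIdeal.2 fun t ht => ?_⟩
  rw [← hg, sub_sub_cancel, eval_hyperplanePullback]
  refine mem_realVanishingIdeal.1 hf _ ⟨hT t ht _, ?_⟩
  rw [Set.mem_ofPred_eq, dotProduct_add, dotProduct_smul, hxu, smul_eq_mul, mul_one,
    add_sub_cancel]

theorem IsUnionOfLines.dirDeriv_iterate_mem_of_affForm_mul {T : Set (Fin n → ℝ)}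
    {x η : Fin n → ℝ} (hT : IsUnionOfLines T η) (hx : η ⬝ᵥ x ≠ 0) {c : ℝ} {g : Poly n} {k m : ℕ}
    (hmk : m ≤ k + 1) (hg : (dirDeriv η)^[m] (affForm x c * g) ∈ realVanishingIdeal T) :
    (dirDeriv η)^[k] g ∈ realVanishingIdeal T := by
  have descend (j : ℕ) (hkj : k ≤ j) (hj : (dirDeriv η)^[j + 1] g ∈ realVanishingIdeal T) :
      (dirDeriv η)^[j] g ∈ realVanishingIdeal T := by
    have leibniz := hT.dirDeriv_iterate_mem_of_le (show m ≤ j + 1 by omega) hg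
    rw [dirDeriv_iterate_mul η (dirDeriv_affForm η x c), Nat.add_sub_cancel,
      Ideal.add_mem_iff_right _ (Ideal.mul_mem_left _ _ hj)] at leibniz
    refine (Ideal.unit_mul_mem_iff_mem _ (IsUnit.map C (IsUnit.mk0 _ ?_))).1 leibniz
    exact mul_ne_zero (Nat.cast_ne_zero.2 j.succ_ne_zero) (Complex.ofReal_ne_zero.2 hx)
  obtain ⟨N, hN⟩ := exists_dirDeriv_iterate_eq_zero η g
  refine Nat.decreasingInduction' (fun j _ hkj => descend j hkj) (le_max_right N k) ?_
  rw [dirDeriv_iterate_eq_zero_of_le (le_max_left N k) hN]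
  exact zero_mem _

end RealVanishingIdeal

section Normal

variable {n : ℕ}

theorem exists_dotProduct_eq (φ : Module.Dual ℝ (Fin n → ℝ)) :
    ∃ u : Fin n → ℝ, ∀ w, w ⬝ᵥ u = φ w := by
  obtain ⟨u, rfl⟩ := (dotProductEquiv ℝ (Fin n)).surjective φ
  exact ⟨u, fun w => dotProduct_comm w u⟩

theorem exists_dotProduct_eq_one {W : Submodule ℝ (Fin n → ℝ)} {x : Fin n → ℝ} (hx : x ∉ W) :
    ∃ u : Fin n → ℝ, x ⬝ᵥ u = 1 ∧ ∀ w ∈ W, u ⬝ᵥ w = 0 := by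
  obtain ⟨φ, hφ, hW⟩ := Submodule.exists_le_ker_of_notMem hx
  obtain ⟨u, hu⟩ := exists_dotProduct_eq ((φ x)⁻¹ • φ)
  refine ⟨u, ?_, fun w hw => ?_⟩
  · rw [hu, LinearMap.smul_apply, smul_eq_mul, inv_mul_cancel₀ hφ]
  · rw [dotProduct_comm, hu, LinearMap.smul_apply, LinearMap.mem_ker.1 (hW hw), smul_zero]

theorem eq_zero_of_forall_dotProduct {η : Fin n → ℝ} {s : Set (Fin n → ℝ)}
    (hs : Submodule.span ℝ s = ⊤) (h : ∀ x ∈ s, η ⬝ᵥ x = 0) : η = 0 :=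
  (dotProductEquiv ℝ (Fin n)).map_eq_zero_iff.1 (LinearMap.ext_on hs h)

theorem sup_span_singleton_eq_top {H : Submodule ℝ (Fin n → ℝ)}
    (hH : Module.finrank ℝ H + 1 = n) {x : Fin n → ℝ} (hx : x ∉ H) :
    H ⊔ Submodule.span ℝ {x} = ⊤ := by
  apply Submodule.eq_top_of_finrank_eq
  rw [Submodule.finrank_sup_span_singleton hx, hH, Module.finrank_fin_fun]

theorem notMem_of_sup_span_singleton_eq_top {H : Submodule ℝ (Fin n → ℝ)} (hH : H ≠ ⊤)
    {x : Fin n → ℝ} (hx : H ⊔ Submodule.span ℝ {x} = ⊤) : x ∉ H := fun h =>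
  hH (by rwa [sup_eq_left.2 ((Submodule.span_singleton_le_iff_mem _ _).2 h)] at hx)

theorem finrank_add_one_eq {H : Submodule ℝ (Fin n → ℝ)} (hH : H ≠ ⊤) {x : Fin n → ℝ}
    (hx : H ⊔ Submodule.span ℝ {x} = ⊤) : Module.finrank ℝ H + 1 = n := by
  rw [← Submodule.finrank_sup_span_singleton (notMem_of_sup_span_singleton_eq_top hH hx), hx,
    finrank_top, Module.finrank_fin_fun]

/-- `η` is a nonzero normal vector of the subspace `H`. -/
structure IsNormal (H : Submodule ℝ (Fin n → ℝ)) (η : Fin n → ℝ) : Prop where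
  ne_zero : η ≠ 0
  dotProduct_eq_zero : ∀ h ∈ H, η ⬝ᵥ h = 0

theorem exists_isNormal {H : Submodule ℝ (Fin n → ℝ)} (hH : H ≠ ⊤) : ∃ η, IsNormal H η := by
  obtain ⟨x, -, hx⟩ := SetLike.exists_of_lt (lt_top_iff_ne_top.2 hH)
  obtain ⟨η, hηx, hηH⟩ := exists_dotProduct_eq_one hx
  exact ⟨η, fun h => by simp [h] at hηx, hηH⟩

theorem IsNormal.dotProduct_ne_zero {H : Submodule ℝ (Fin n → ℝ)} {η : Fin n → ℝ}
    (hη : IsNormal H η) (hH : Module.finrank ℝ H + 1 = n) {x : Fin n → ℝ} (hx : x ∉ H) :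
    η ⬝ᵥ x ≠ 0 := by
  refine fun hηx => hη.ne_zero (eq_zero_of_forall_dotProduct (s := H ∪ {x}) ?_ ?_)
  · rw [Submodule.span_union, Submodule.span_eq, sup_span_singleton_eq_top hH hx]
  · rintro y (hy | rfl)
    exacts [hη.dotProduct_eq_zero y hy, hηx]

end Normal

section Flat

variable {n : ℕ} {ι : Type*} {X : ι → Fin n → ℝ} {lam : ι → ℝ} {A B Z : Finset ι} {i : ι}

/-- The linear span of the vectors with index in `A`. -/
abbrev vecSpan (X : ι → Fin n → ℝ) (A : Finset ι) : Submodule ℝ (Fin n → ℝ) :=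
  Submodule.span ℝ (X '' (A : Set ι))

theorem mem_vecSpan (hi : i ∈ A) : X i ∈ vecSpan X A :=
  Submodule.subset_span ⟨i, hi, rfl⟩

theorem vecSpan_mono (X : ι → Fin n → ℝ) (h : A ⊆ B) : vecSpan X A ≤ vecSpan X B :=
  Submodule.span_mono (Set.image_mono (Finset.coe_subset.2 h))

theorem vecSpan_le {H : Submodule ℝ (Fin n → ℝ)} : vecSpan X A ≤ H ↔ ∀ i ∈ A, X i ∈ H :=
  Submodule.span_le.trans Set.forall_mem_image

theorem vecSpan_insert [DecidableEq ι] (X : ι → Fin n → ℝ) (A : Finset ι) (i : ι) :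
    vecSpan X (insert i A) = vecSpan X A ⊔ Submodule.span ℝ {X i} := by
  rw [vecSpan, Finset.coe_insert, Set.image_insert_eq, Submodule.span_insert, sup_comm]

theorem vecSpan_insert_of_mem [DecidableEq ι] (hi : X i ∈ vecSpan X A) :
    vecSpan X (insert i A) = vecSpan X A := by
  rw [vecSpan_insert, sup_eq_left, Submodule.span_singleton_le_iff_mem]
  exact hi

theorem vecSpan_univ [Fintype ι] (X : ι → Fin n → ℝ) :
    vecSpan X Finset.univ = Submodule.span ℝ (Set.range X) := by
  rw [vecSpan, Finset.coe_univ, Set.image_univ]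

/-- The common points of the hyperplanes `x · t = λ_x` with index in `Z`. -/
def affFlat (X : ι → Fin n → ℝ) (lam : ι → ℝ) (Z : Finset ι) : Set (Fin n → ℝ) :=
  {t | ∀ i ∈ Z, X i ⬝ᵥ t = lam i}

theorem affFlat_empty (X : ι → Fin n → ℝ) (lam : ι → ℝ) : affFlat X lam ∅ = Set.univ := by
  simp [affFlat]

theorem affFlat_insert [DecidableEq ι] (X : ι → Fin n → ℝ) (lam : ι → ℝ) (Z : Finset ι) (i : ι) :
    affFlat X lam (insert i Z) = affFlat X lam Z ∩ {t | X i ⬝ᵥ t = lam i} := by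
  ext t
  simp [affFlat, and_comm]

theorem isUnionOfLines_affFlat {u : Fin n → ℝ} (hu : ∀ w ∈ vecSpan X Z, u ⬝ᵥ w = 0) :
    IsUnionOfLines (affFlat X lam Z) u := by
  intro t ht s i hi
  rw [dotProduct_add, dotProduct_smul, dotProduct_comm (X i) u, hu _ (mem_vecSpan hi), smul_zero,
    add_zero]
  exact ht i hi

end Flat

/-! ### Facet hyperplanes of contractions -/

section RelFacet

variable {n : ℕ} {ι : Type*} {X : ι → Fin n → ℝ} {A Z : Finset ι}
  {H : Submodule ℝ (Fin n → ℝ)} {η : Fin n → ℝ} {x : ι}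

/-- `H` is a hyperplane that contains `Z` and is spanned by vectors of `A ∪ Z`.  These are the
facet hyperplanes of the contraction of `A ∪ Z` by `Z`. -/
structure IsRelFacet [DecidableEq ι] (X : ι → Fin n → ℝ) (A Z : Finset ι)
    (H : Submodule ℝ (Fin n → ℝ)) : Prop where
  finrank_add_one : Module.finrank ℝ H + 1 = n
  vecSpan_le : vecSpan X Z ≤ H
  le_span : H ≤ Submodule.span ℝ (X '' {i | i ∈ A ∪ Z ∧ X i ∈ H})

open scoped Classical in
/-- The number of vectors of `A` outside `H`; the version of `facetMult` for sub-multisets. -/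
noncomputable def relFacetMult (X : ι → Fin n → ℝ) (A : Finset ι)
    (H : Submodule ℝ (Fin n → ℝ)) : ℕ :=
  (A.filter fun i => X i ∉ H).card

theorem relFacetMult_univ [Fintype ι] (X : ι → Fin n → ℝ) (H : Submodule ℝ (Fin n → ℝ)) :
    relFacetMult X Finset.univ H = facetMult X H := by
  classical
  rw [relFacetMult, facetMult, Set.ncard_eq_toFinset_card' {i | X i ∉ H}]
  congr 1
  ext i
  simp

theorem relFacetMult_eq_zero (hA : ∀ i ∈ A, X i ∈ H) : relFacetMult X A H = 0 := by
  classical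
  rw [relFacetMult, Finset.card_filter_eq_zero_iff]
  exact fun i hi => not_not.2 (hA i hi)

variable [DecidableEq ι]

theorem relFacetMult_insert_of_mem (hx : X x ∈ H) :
    relFacetMult X (insert x A) H = relFacetMult X A H := by
  rw [relFacetMult, Finset.filter_insert, if_neg (not_not.2 hx), relFacetMult]

theorem relFacetMult_insert_of_notMem (hxA : x ∉ A) (hx : X x ∉ H) :
    relFacetMult X (insert x A) H = relFacetMult X A H + 1 := by
  rw [relFacetMult, Finset.filter_insert, if_pos hx,
    Finset.card_insert_of_notMem (by simp [hxA]), relFacetMult]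

theorem relFacetMult_insert_le (X : ι → Fin n → ℝ) (A : Finset ι)
    (H : Submodule ℝ (Fin n → ℝ)) (x : ι) :
    relFacetMult X (insert x A) H ≤ relFacetMult X A H + 1 := by
  rw [relFacetMult, Finset.filter_insert, relFacetMult]
  split_ifs with hx
  · exact Nat.le_succ _
  · exact Finset.card_insert_le x _

theorem exists_notMem_of_vecSpan_eq_top (hH : Module.finrank ℝ H + 1 = n)
    (hspan : vecSpan X (A ∪ Z) = ⊤) (hZ : vecSpan X Z ≤ H) : ∃ i ∈ A, X i ∉ H := by
  by_contra! hA
  have top_le : vecSpan X (A ∪ Z) ≤ H := vecSpan_le.2 fun i hi =>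
    (Finset.mem_union.1 hi).elim (hA i) fun hi => hZ (mem_vecSpan hi)
  rw [hspan, top_le_iff] at top_le
  rw [top_le, finrank_top, Module.finrank_fin_fun] at hH
  omega

theorem relFacetMult_pos (hH : Module.finrank ℝ H + 1 = n) (hspan : vecSpan X (A ∪ Z) = ⊤)
    (hZ : vecSpan X Z ≤ H) : 0 < relFacetMult X A H := by
  classical
  obtain ⟨i, hi, hiH⟩ := exists_notMem_of_vecSpan_eq_top hH hspan hZ
  exact Finset.card_pos.2 ⟨i, Finset.mem_filter.2 ⟨hi, hiH⟩⟩

theorem IsRelFacet.mono_insert (hH : IsRelFacet X A Z H) (x : ι) :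
    IsRelFacet X (insert x A) Z H where
  finrank_add_one := hH.finrank_add_one
  vecSpan_le := hH.vecSpan_le
  le_span := hH.le_span.trans <| Submodule.span_mono <| Set.image_mono fun _ hi =>
    ⟨Finset.union_subset_union (Finset.subset_insert _ _) subset_rfl hi.1, hi.2⟩

theorem IsRelFacet.of_contract (hH : IsRelFacet X A (insert x Z) H) :
    IsRelFacet X (insert x A) Z H where
  finrank_add_one := hH.finrank_add_one
  vecSpan_le := (vecSpan_mono X (Finset.subset_insert x Z)).trans hH.vecSpan_le
  le_span := by rw [Finset.insert_union, ← Finset.union_insert]; exact hH.le_span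

theorem isRelFacet_vecSpan_of_coloop (hspan : vecSpan X (insert x A ∪ Z) = ⊤)
    (hAZ : vecSpan X (A ∪ Z) ≠ ⊤) : IsRelFacet X (insert x A) Z (vecSpan X (A ∪ Z)) where
  finrank_add_one := finrank_add_one_eq (x := X x) hAZ
    (by rw [← vecSpan_insert, ← Finset.insert_union, hspan])
  vecSpan_le := vecSpan_mono X Finset.subset_union_right
  le_span := Submodule.span_mono <| Set.image_mono fun _ hi =>
    ⟨Finset.union_subset_union (Finset.subset_insert _ _) subset_rfl hi, mem_vecSpan hi⟩

theorem IsRelFacet.isUnionOfLines (hH : IsRelFacet X A Z H) (hη : IsNormal H η) (lam : ι → ℝ) :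
    IsUnionOfLines (affFlat X lam Z) η :=
  isUnionOfLines_affFlat fun w hw => hη.dotProduct_eq_zero w (hH.vecSpan_le hw)

theorem isRelFacet_univ_iff [Fintype ι] :
    IsRelFacet X Finset.univ ∅ H ↔ IsFacetHyperplane X H := by
  have image_eq : X '' {i | i ∈ Finset.univ ∪ (∅ : Finset ι) ∧ X i ∈ H} =
      Set.range X ∩ (H : Set (Fin n → ℝ)) := by
    ext y
    simp only [Finset.union_empty, Finset.mem_univ, true_and, Set.mem_image, Set.mem_ofPred_eq,
      Set.mem_inter_iff, Set.mem_range, SetLike.mem_coe]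
    exact ⟨fun ⟨i, hi, h⟩ => ⟨⟨i, h⟩, h ▸ hi⟩, fun ⟨⟨i, h⟩, hy⟩ => ⟨i, h ▸ hy, h⟩⟩
  refine ⟨fun hH => ⟨hH.finrank_add_one, le_antisymm ?_ (image_eq ▸ hH.le_span)⟩,
    fun hH => ⟨hH.1, by simp [vecSpan], by rw [image_eq, hH.2]⟩⟩
  exact Submodule.span_le.2 Set.inter_subset_right

end RelFacet

section FacetKernel

variable {n : ℕ} {ι : Type*} [DecidableEq ι] {X : ι → Fin n → ℝ} {lam : ι → ℝ} {e : ℕ}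
  {A Z : Finset ι} {f g : Poly n} {x : ι}

/-- The polynomials `f` such that, for every facet hyperplane `H` of the contraction of `A ∪ Z` by
`Z`, the derivative of `f` of order `m(H) - e` in the normal direction of `H` vanishes on the flat
of `Z`.  The central case is `e = 0`, the internal case is `e = 1`. -/
noncomputable def facetKernel (X : ι → Fin n → ℝ) (lam : ι → ℝ) (e : ℕ) (A Z : Finset ι) :
    Submodule ℂ (Poly n) where
  carrier := {f | ∀ H η, IsRelFacet X A Z H → IsNormal H η →
    (dirDeriv η)^[relFacetMult X A H - e] f ∈ realVanishingIdeal (affFlat X lam Z)}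
  add_mem' hf hg H η hH hη := by
    rw [iterate_map_add]
    exact add_mem (hf H η hH hη) (hg H η hH hη)
  zero_mem' H η _ _ := by
    rw [iterate_map_zero]
    exact zero_mem _
  smul_mem' c f hf H η hH hη := by
    rw [dirDeriv_iterate_smul]
    exact Submodule.smul_of_tower_mem _ c (hf H η hH hη)

theorem mem_facetKernel_of_mem_realVanishingIdeal (e : ℕ) (A : Finset ι)
    (hf : f ∈ realVanishingIdeal (affFlat X lam Z)) : f ∈ facetKernel X lam e A Z :=
  fun _ _ hH hη => (hH.isUnionOfLines hη lam).dirDeriv_iterate_mem hf _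

theorem mem_facetKernel_of_loop (hx : X x ∈ vecSpan X Z)
    (hf : f ∈ facetKernel X lam e (insert x A) Z) : f ∈ facetKernel X lam e A Z := by
  intro H η hH hη
  rw [← relFacetMult_insert_of_mem (hH.vecSpan_le hx)]
  exact hf H η (hH.mono_insert x) hη

theorem mem_facetKernel_contract (hf : f ∈ facetKernel X lam e (insert x A) Z) :
    f ∈ facetKernel X lam e A (insert x Z) := by
  intro H η hH hη
  rw [← relFacetMult_insert_of_mem (hH.vecSpan_le (mem_vecSpan (Finset.mem_insert_self x Z)))]
  refine realVanishingIdeal_anti ?_ (hf H η hH.of_contract hη)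
  exact (affFlat_insert X lam Z x).trans_subset Set.inter_subset_left

theorem mem_facetKernel_delete (hxA : x ∉ A) (hx : X x ∉ vecSpan X Z)
    (he : ∀ H, IsRelFacet X A Z H → e ≤ relFacetMult X A H)
    (hg : affForm (X x) (lam x) * g ∈ facetKernel X lam e (insert x A) Z) :
    g ∈ facetKernel X lam e A Z := by
  intro H η hH hη
  have hgH := hg H η (hH.mono_insert x) hη
  by_cases hxH : X x ∈ H
  · obtain ⟨u, hu, huZ⟩ := exists_dotProduct_eq_one hx
    rw [relFacetMult_insert_of_mem hxH, dirDeriv_iterate_mul η (dirDeriv_affForm _ _ _),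
      hη.dotProduct_eq_zero _ hxH, Complex.ofReal_zero, mul_zero, C_0, zero_mul, add_zero] at hgH
    exact (isUnionOfLines_affFlat huZ).mem_of_affForm_mul_mem (by simp [hu]) _ hgH
  · rw [relFacetMult_insert_of_notMem hxA hxH] at hgH
    have := he H hH
    exact (hH.isUnionOfLines hη lam).dirDeriv_iterate_mem_of_affForm_mul
      (hη.dotProduct_ne_zero hH.finrank_add_one hxH) (by omega) hgH

theorem mem_facetKernel_of_succ (hf : f ∈ facetKernel X lam (e + 1) (insert x A) Z) :
    f ∈ facetKernel X lam e A Z := by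
  intro H η hH hη
  refine (hH.isUnionOfLines hη lam).dirDeriv_iterate_mem_of_le ?_ (hf H η (hH.mono_insert x) hη)
  have := relFacetMult_insert_le X A H x
  omega

/-- The other vectors span a facet hyperplane of multiplicity one. -/
theorem exists_isNormal_dirDeriv_iterate_mem_of_coloop (hspan : vecSpan X (insert x A ∪ Z) = ⊤)
    (hAZ : vecSpan X (A ∪ Z) ≠ ⊤) (hf : f ∈ facetKernel X lam e (insert x A) Z) :
    ∃ η, IsNormal (vecSpan X (A ∪ Z)) η ∧
      (dirDeriv η)^[1 - e] f ∈ realVanishingIdeal (affFlat X lam Z) := by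
  have hH := isRelFacet_vecSpan_of_coloop hspan hAZ
  obtain ⟨η, hη⟩ := exists_isNormal hAZ
  refine ⟨η, hη, ?_⟩
  have mult_le : relFacetMult X (insert x A) (vecSpan X (A ∪ Z)) ≤ 1 := by
    have := relFacetMult_insert_le X A (vecSpan X (A ∪ Z)) x
    rwa [relFacetMult_eq_zero fun i hi => mem_vecSpan (Finset.mem_union_left _ hi)] at this
  exact (hH.isUnionOfLines hη lam).dirDeriv_iterate_mem_of_le (by omega) (hf _ η hH hη)

theorem mem_realVanishingIdeal_of_coloop (hspan : vecSpan X (insert x A ∪ Z) = ⊤)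
    (hAZ : vecSpan X (A ∪ Z) ≠ ⊤) (hf : f ∈ facetKernel X lam 1 (insert x A) Z) :
    f ∈ realVanishingIdeal (affFlat X lam Z) := by
  obtain ⟨η, -, hfη⟩ := exists_isNormal_dirDeriv_iterate_mem_of_coloop hspan hAZ hf
  exact hfη

theorem mem_realVanishingIdeal_of_affForm_mul_mem_of_coloop
    (hspan : vecSpan X (insert x A ∪ Z) = ⊤) (hAZ : vecSpan X (A ∪ Z) ≠ ⊤)
    (hg : affForm (X x) (lam x) * g ∈ facetKernel X lam 0 (insert x A) Z) :
    g ∈ realVanishingIdeal (affFlat X lam Z) := by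
  obtain ⟨η, hη, hgη⟩ := exists_isNormal_dirDeriv_iterate_mem_of_coloop hspan hAZ hg
  have hH := isRelFacet_vecSpan_of_coloop hspan hAZ
  have hxH : X x ∉ vecSpan X (A ∪ Z) := notMem_of_sup_span_singleton_eq_top hAZ
    (by rw [← vecSpan_insert, ← Finset.insert_union, hspan])
  exact (hH.isUnionOfLines hη lam).dirDeriv_iterate_mem_of_affForm_mul (k := 0)
    (hη.dotProduct_ne_zero hH.finrank_add_one hxH) le_rfl hgη

theorem exists_sub_affForm_mul_mem (hx : X x ∉ vecSpan X Z)
    (hf : f ∈ facetKernel X lam e A Z)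
    (hfx : f ∈ realVanishingIdeal (affFlat X lam (insert x Z))) :
    ∃ g, f - affForm (X x) (lam x) * g ∈ realVanishingIdeal (affFlat X lam Z) ∧
      affForm (X x) (lam x) * g ∈ facetKernel X lam e A Z := by
  obtain ⟨u, hu, huZ⟩ := exists_dotProduct_eq_one hx
  rw [affFlat_insert] at hfx
  obtain ⟨g, hg⟩ := (isUnionOfLines_affFlat huZ).exists_sub_affForm_mul_mem hu hfx
  refine ⟨g, hg, ?_⟩
  rw [← sub_sub_cancel f (_ * g)]
  exact sub_mem hf (mem_facetKernel_of_mem_realVanishingIdeal e A hg)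

end FacetKernel

/-! ### Central spaces -/

section Central

variable {n : ℕ} {ι : Type*} {X : ι → Fin n → ℝ} {lam : ι → ℝ} {A Z : Finset ι}
  {f : Poly n} {x : ι}

theorem sub_C_eval_zero_mem_realVanishingIdeal (hZ : vecSpan X Z = ⊤) (f : Poly n) :
    f - C (eval 0 f) ∈ realVanishingIdeal (affFlat X 0 Z) := by
  refine mem_realVanishingIdeal.2 fun t ht => ?_
  have ht_zero : t = 0 := eq_zero_of_forall_dotProduct hZ <| Set.forall_mem_image.2 fun i hi =>
    (dotProduct_comm _ _).trans (ht i hi)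
  have point_zero : complexPoint (0 : Fin n → ℝ) = 0 := funext fun _ => Complex.ofReal_zero
  rw [ht_zero, point_zero, map_sub, eval_C, sub_self]

theorem prodForm_empty (X : ι → Fin n → ℝ) : prodForm X ∅ = 1 :=
  Finset.prod_empty

variable [DecidableEq ι]

theorem prodForm_insert (X : ι → Fin n → ℝ) {Y : Finset ι} (hx : x ∉ Y) :
    prodForm X (insert x Y) = linForm (X x) * prodForm X Y :=
  Finset.prod_insert hx

/-- The central space of the contraction of `A ∪ Z` by `Z`. -/
noncomputable def relCentralP (X : ι → Fin n → ℝ) (A Z : Finset ι) : Submodule ℂ (Poly n) :=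
  Submodule.span ℂ {p | ∃ Y ⊆ A, vecSpan X (A \ Y ∪ Z) = ⊤ ∧ p = prodForm X Y}

theorem relCentralP_empty_right (X : ι → Fin n → ℝ) (A : Finset ι) :
    relCentralP X A ∅ = centralP X A := by
  simp only [relCentralP, centralP, Finset.union_empty, vecSpan]

theorem C_mem_relCentralP (hspan : vecSpan X (A ∪ Z) = ⊤) (c : ℂ) :
    C c ∈ relCentralP X A Z := by
  rw [← mul_one (C c), ← smul_eq_C_mul, ← prodForm_empty X]
  exact Submodule.smul_mem _ _ (Submodule.subset_span
    ⟨∅, Finset.empty_subset _, by rwa [Finset.sdiff_empty], rfl⟩)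

theorem relCentralP_le_insert (X : ι → Fin n → ℝ) (A Z : Finset ι) (x : ι) :
    relCentralP X A Z ≤ relCentralP X (insert x A) Z := by
  refine Submodule.span_mono ?_
  rintro _ ⟨Y, hY, hspan, rfl⟩
  refine ⟨Y, hY.trans (Finset.subset_insert _ _), top_le_iff.1 (hspan ▸ ?_), rfl⟩
  exact vecSpan_mono X (Finset.union_subset_union
    (Finset.sdiff_subset_sdiff (Finset.subset_insert _ _) subset_rfl) subset_rfl)

theorem relCentralP_contract_le (hxA : x ∉ A) :
    relCentralP X A (insert x Z) ≤ relCentralP X (insert x A) Z := by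
  refine Submodule.span_mono ?_
  rintro _ ⟨Y, hY, hspan, rfl⟩
  refine ⟨Y, hY.trans (Finset.subset_insert _ _), ?_, rfl⟩
  rwa [Finset.insert_sdiff_of_notMem _ (fun h => hxA (hY h)), Finset.insert_union,
    ← Finset.union_insert]

theorem linForm_mul_mem_relCentralP (hxA : x ∉ A) (hf : f ∈ relCentralP X A Z) :
    linForm (X x) * f ∈ relCentralP X (insert x A) Z := by
  induction hf using Submodule.span_induction with
  | zero => rw [mul_zero]; exact zero_mem _
  | add p q _ _ hp hq => rw [mul_add]; exact add_mem hp hq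
  | smul c p _ hp => rw [mul_smul_comm]; exact Submodule.smul_mem _ _ hp
  | mem p hp =>
    obtain ⟨Y, hY, hspan, rfl⟩ := hp
    refine Submodule.subset_span ⟨insert x Y, Finset.insert_subset_insert x hY, ?_,
      (prodForm_insert X fun h => hxA (hY h)).symm⟩
    rwa [Finset.insert_sdiff_insert, Finset.sdiff_insert_of_notMem hxA]

theorem dirDeriv_iterate_eq_zero_of_mem_relCentralP {H : Submodule ℝ (Fin n → ℝ)}
    {η : Fin n → ℝ} (hH : Module.finrank ℝ H + 1 = n) (hZ : vecSpan X Z ≤ H)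
    (hη : IsNormal H η) (hf : f ∈ relCentralP X A Z) :
    (dirDeriv η)^[relFacetMult X A H] f = 0 := by
  classical
  induction hf using Submodule.span_induction with
  | zero => exact iterate_map_zero _ _
  | add p q _ _ hp hq => rw [iterate_map_add, hp, hq, add_zero]
  | smul c p _ hp => rw [dirDeriv_iterate_smul, hp, smul_zero]
  | mem p hp =>
    obtain ⟨Y, hY, hspan, rfl⟩ := hp
    refine dirDeriv_iterate_prod_linForm_eq_zero _ _ _ (Finset.card_lt_card ?_)
    obtain ⟨i, hi, hiH⟩ := exists_notMem_of_vecSpan_eq_top hH hspan hZ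
    obtain ⟨hiA, hiY⟩ := Finset.mem_sdiff.1 hi
    refine (Finset.ssubset_iff_of_subset fun j hj => ?_).2
      ⟨i, Finset.mem_filter.2 ⟨hiA, hiH⟩, fun h => hiY (Finset.mem_filter.1 h).1⟩
    rw [Finset.mem_filter] at hj ⊢
    exact ⟨hY hj.1, fun hjH => hj.2 (hη.dotProduct_eq_zero _ hjH)⟩

theorem relCentralP_le_facetKernel (X : ι → Fin n → ℝ) (lam : ι → ℝ) (A Z : Finset ι) :
    relCentralP X A Z ≤ facetKernel X lam 0 A Z := by
  intro f hf H η hH hη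
  rw [Nat.sub_zero, dirDeriv_iterate_eq_zero_of_mem_relCentralP hH.finrank_add_one hH.vecSpan_le
    hη hf]
  exact zero_mem _

/-- Deletion and contraction of `x ∈ A` decompose `f` on the flat of `Z` as `g + p_x k`, with `g`
in the central space of the contraction and `k` in that of the deletion. -/
theorem exists_mem_relCentralP_sub_mem (hspan : vecSpan X (A ∪ Z) = ⊤)
    (hf : f ∈ facetKernel X 0 0 A Z) :
    ∃ g ∈ relCentralP X A Z, f - g ∈ realVanishingIdeal (affFlat X 0 Z) := by
  induction A using Finset.induction_on generalizing Z f with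
  | empty =>
    exact ⟨_, C_mem_relCentralP hspan _,
      sub_C_eval_zero_mem_realVanishingIdeal (by rwa [Finset.empty_union] at hspan) f⟩
  | insert x A hxA ih =>
    by_cases hx : X x ∈ vecSpan X Z
    · rw [Finset.insert_union,
        vecSpan_insert_of_mem (vecSpan_mono X Finset.subset_union_right hx)] at hspan
      obtain ⟨g, hg, hfg⟩ := ih hspan (mem_facetKernel_of_loop hx hf)
      exact ⟨g, relCentralP_le_insert X A Z x hg, hfg⟩
    obtain ⟨g, hg, hfg⟩ := ih (Z := insert x Z) (by rwa [Finset.union_insert,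
      ← Finset.insert_union]) (mem_facetKernel_contract hf)
    have hg_insert := relCentralP_contract_le hxA hg
    obtain ⟨h, hfgh, hh⟩ := exists_sub_affForm_mul_mem hx
      (sub_mem hf (relCentralP_le_facetKernel X 0 _ Z hg_insert)) hfg
    by_cases hAZ : vecSpan X (A ∪ Z) = ⊤
    · obtain ⟨k, hk, hhk⟩ := ih hAZ (mem_facetKernel_delete hxA hx (fun _ _ => zero_le) hh)
      refine ⟨g + linForm (X x) * k, add_mem hg_insert (linForm_mul_mem_relCentralP hxA hk), ?_⟩
      convert add_mem hfgh (Ideal.mul_mem_left _ (affForm (X x) ((0 : ι → ℝ) x)) hhk) using 1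
      rw [Pi.zero_apply, affForm_zero]
      ring
    · refine ⟨g, hg_insert, ?_⟩
      have hh_mem := mem_realVanishingIdeal_of_affForm_mul_mem_of_coloop hspan hAZ hh
      exact (Submodule.sub_mem_iff_left _ (Ideal.mul_mem_left _ _ hh_mem)).1 hfgh

end Central

section Internal

variable {n : ℕ} {ι : Type*} [Fintype ι] [DecidableEq ι] {X : ι → Fin n → ℝ} {f : Poly n}

theorem mem_idealPerp_internalI_iff_facetKernel (lam : ι → ℝ) :
    f ∈ idealPerp (internalI X) ↔ f ∈ facetKernel X lam 1 Finset.univ ∅ := by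
  rw [mem_idealPerp_internalI]
  refine forall₂_congr fun H η => ?_
  rw [affFlat_empty, realVanishingIdeal_univ, relFacetMult_univ, isRelFacet_univ_iff]
  exact ⟨fun h hH hη => h hH hη.1 hη.2, fun h hH h1 h2 => h hH ⟨h1, h2⟩⟩

theorem idealPerp_internalI_le_centralP (hX : Submodule.span ℝ (Set.range X) = ⊤) (x : ι) :
    idealPerp (internalI X) ≤ centralP X (Finset.univ.erase x) := by
  intro f hf
  have hspan : vecSpan X (insert x (Finset.univ.erase x) ∪ ∅) = ⊤ := by
    rw [Finset.insert_erase (Finset.mem_univ x), Finset.union_empty, vecSpan_univ, hX]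
  rw [mem_idealPerp_internalI_iff_facetKernel 0, ← Finset.insert_erase (Finset.mem_univ x)] at hf
  by_cases hs : vecSpan X (Finset.univ.erase x ∪ ∅) = ⊤
  · obtain ⟨g, hg, hfg⟩ := exists_mem_relCentralP_sub_mem hs (mem_facetKernel_of_succ hf)
    rw [affFlat_empty, realVanishingIdeal_univ, Submodule.mem_bot, sub_eq_zero] at hfg
    rwa [hfg, ← relCentralP_empty_right]
  · have hf_zero := mem_realVanishingIdeal_of_coloop hspan hs hf
    rw [affFlat_empty, realVanishingIdeal_univ, Submodule.mem_bot] at hf_zero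
    rw [hf_zero]
    exact zero_mem _

theorem internalP_le_idealPerp (hX : Submodule.span ℝ (Set.range X) = ⊤) :
    internalP X ≤ idealPerp (internalI X) := by
  intro f hf
  refine mem_idealPerp_internalI.2 fun H η hH hη_ne hη => ?_
  have hspan : vecSpan X (Finset.univ ∪ ∅) = ⊤ := by
    rw [Finset.union_empty, vecSpan_univ, hX]
  have hempty : vecSpan X ∅ ≤ H := by simp [vecSpan]
  obtain ⟨x, -, hx⟩ := exists_notMem_of_vecSpan_eq_top hH.1 hspan hempty
  have hfx := (Submodule.mem_iInf _).1 hf x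
  rw [← relCentralP_empty_right] at hfx
  have mult_eq := relFacetMult_insert_of_notMem (Finset.notMem_erase x Finset.univ) hx
  rw [Finset.insert_erase (Finset.mem_univ x), relFacetMult_univ] at mult_eq
  rw [mult_eq, Nat.add_sub_cancel]
  exact dirDeriv_iterate_eq_zero_of_mem_relCentralP hH.1 hempty ⟨hη_ne, hη⟩ hfx

theorem internalP_eq_idealPerp (hX : Submodule.span ℝ (Set.range X) = ⊤) :
    internalP X = idealPerp (internalI X) :=
  le_antisymm (internalP_le_idealPerp hX) (le_iInf (idealPerp_internalI_le_centralP hX))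

end Internal

/-! ### Vertices of generic arrangements -/

section InternalVertices

variable {n : ℕ} {ι : Type*} {X : ι → Fin n → ℝ} {lam : ι → ℝ} {A Z B : Finset ι} {x : ι}

/-- The basis of `ℝⁿ` given by a basis of the configuration. -/
noncomputable def IsBasis.basis (hB : IsBasis X B) : Module.Basis B ℝ (Fin n → ℝ) :=
  Module.Basis.mk (v := fun i : B => X i) hB.1 (by
    have span_eq := hB.2
    rw [Set.image_eq_range] at span_eq
    exact span_eq.ge)

theorem IsBasis.basis_apply (hB : IsBasis X B) (i : B) : hB.basis i = X i :=
  Module.Basis.mk_apply _ _ _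

theorem IsBasis.card_eq (hB : IsBasis X B) : B.card = n := by
  rw [← Fintype.card_coe, ← Module.finrank_eq_card_basis hB.basis, Module.finrank_fin_fun]

theorem IsGeneric.dotProduct_ne (hlam : IsGeneric X lam) (hB : IsBasis X B) {v : Fin n → ℝ}
    (hv : v ∈ affFlat X lam B) (hx : x ∉ B) : X x ⬝ᵥ v ≠ lam x := by
  classical
  exact fun h => hlam (insert x B) (by rw [Finset.card_insert_of_notMem hx, hB.card_eq])
    ⟨v, Finset.forall_mem_insert _ _ _ |>.2 ⟨h, hv⟩⟩

variable [LinearOrder ι]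

/-- The internal bases of the contraction of `A ∪ Z` by `Z`. -/
structure IsRelInternalBasis (X : ι → Fin n → ℝ) (A Z B : Finset ι) : Prop where
  subset : B ⊆ A
  isBasis : IsBasis X (B ∪ Z)
  not_isGreatest : ∀ b ∈ B, ¬ IsGreatest {j | j ∈ A ∧ X j ∉ vecSpan X ((B ∪ Z).erase b)} b

theorem isRelInternalBasis_univ_iff [Fintype ι] :
    IsRelInternalBasis X Finset.univ ∅ B ↔ B ∈ internalBases X := by
  refine ⟨fun hB => ⟨by simpa using hB.isBasis, fun b hb h => hB.not_isGreatest b hb ?_⟩,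
    fun hB => ⟨Finset.subset_univ B, by simpa using hB.1, fun b hb h => hB.2 b hb ?_⟩⟩
  · simpa [InternallyActive, vecSpan] using h
  · simpa [InternallyActive, vecSpan] using h

theorem IsRelInternalBasis.mono_insert (hB : IsRelInternalBasis X A Z B) (x : ι) :
    IsRelInternalBasis X (insert x A) Z B where
  subset := hB.subset.trans (Finset.subset_insert x A)
  isBasis := hB.isBasis
  not_isGreatest b hb h := hB.not_isGreatest b hb
    ⟨⟨hB.subset hb, h.1.2⟩, fun _ hj => h.2 ⟨Finset.mem_insert_of_mem hj.1, hj.2⟩⟩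

/-- The element `x` is not active in `insert x B`, since the later vectors `A` already span. -/
theorem IsRelInternalBasis.insert_of_contract (hB : IsRelInternalBasis X A (insert x Z) B)
    (hxA : ∀ a ∈ A, x < a) (hxZ : x ∉ Z) (hspan : vecSpan X (A ∪ Z) = ⊤) :
    IsRelInternalBasis X (insert x A) Z (insert x B) where
  subset := Finset.insert_subset_insert x hB.subset
  isBasis := by
    rw [Finset.insert_union, ← Finset.union_insert]
    exact hB.isBasis
  not_isGreatest b hb h := by
    rw [Finset.insert_union, ← Finset.union_insert] at h
    rcases Finset.mem_insert.1 hb with rfl | hb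
    · refine h.1.2 (vecSpan_le (X := X) (A := A ∪ Z) |>.2 (fun i hi => ?_)
        (hspan ▸ Submodule.mem_top))
      rcases Finset.mem_union.1 hi with hi | hi
      · by_contra hni
        exact (hxA i hi).not_ge (h.2 ⟨Finset.mem_insert_of_mem hi, hni⟩)
      · exact mem_vecSpan (Finset.mem_erase.2 ⟨ne_of_mem_of_not_mem hi hxZ,
          Finset.mem_union_right _ (Finset.mem_insert_of_mem hi)⟩)
    · exact hB.not_isGreatest b hb
        ⟨⟨hB.subset hb, h.1.2⟩, fun _ hj => h.2 ⟨Finset.mem_insert_of_mem hj.1, hj.2⟩⟩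

theorem eval_eq_zero_of_sub_affForm_mul_mem (hlam : IsGeneric X lam) {f g : Poly n}
    (hxA : x ∉ A) (hxZ : x ∉ Z) (hB : IsRelInternalBasis X A Z B) {v : Fin n → ℝ}
    (hv : v ∈ affFlat X lam (B ∪ Z)) (hf : eval (complexPoint v) f = 0)
    (hfg : f - affForm (X x) (lam x) * g ∈ realVanishingIdeal (affFlat X lam Z)) :
    eval (complexPoint v) g = 0 := by
  have hxB : x ∉ B ∪ Z := by
    rw [Finset.mem_union, not_or]
    exact ⟨fun h => hxA (hB.subset h), hxZ⟩
  have eval_mul := mem_realVanishingIdeal.1 hfg v fun i hi => hv i (Finset.mem_union_right _ hi)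
  rw [map_sub, hf, zero_sub, neg_eq_zero, map_mul, eval_affForm] at eval_mul
  exact (mul_eq_zero.1 eval_mul).resolve_left
    (Complex.ofReal_ne_zero.2 (sub_ne_zero.2 (hlam.dotProduct_ne hB.isBasis hv hxB)))

/-- Deletion and contraction of the first element `x` of `A`: as `f` vanishes on the flat of
`Z ∪ {x}`, it is `p_x - λ_x` times some `g` on the flat of `Z`, and `g` vanishes there because
`p_x - λ_x` has no zero at the vertices of the deletion. -/
theorem mem_realVanishingIdeal_of_eval_vertices_eq_zero (hlam : IsGeneric X lam) {f : Poly n}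
    (hZ : LinearIndepOn ℝ X (Z : Set ι)) (hspan : vecSpan X (A ∪ Z) = ⊤)
    (hf : f ∈ facetKernel X lam 1 A Z)
    (hv : ∀ B, IsRelInternalBasis X A Z B →
      ∀ v ∈ affFlat X lam (B ∪ Z), eval (complexPoint v) f = 0) :
    f ∈ realVanishingIdeal (affFlat X lam Z) := by
  induction A using Finset.induction_on_min generalizing Z f with
  | empty =>
    rw [Finset.empty_union] at hspan
    refine mem_realVanishingIdeal.2 fun t ht => hv ∅ ⟨subset_rfl, ?_, by simp⟩ t ?_
    · rw [Finset.empty_union]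
      exact ⟨hZ, hspan⟩
    · rwa [Finset.empty_union]
  | insert x A hmin ih =>
    by_cases hx : X x ∈ vecSpan X Z
    · rw [Finset.insert_union,
        vecSpan_insert_of_mem (vecSpan_mono X Finset.subset_union_right hx)] at hspan
      exact ih hZ hspan (mem_facetKernel_of_loop hx hf) fun B hB => hv B (hB.mono_insert x)
    by_cases hAZ : vecSpan X (A ∪ Z) = ⊤
    swap
    · exact mem_realVanishingIdeal_of_coloop hspan hAZ hf
    have hxA : x ∉ A := fun h => lt_irrefl _ (hmin x h)
    have hxZ : x ∉ Z := fun h => hx (mem_vecSpan h)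
    have hf_contract : f ∈ realVanishingIdeal (affFlat X lam (insert x Z)) := by
      refine ih (by rw [Finset.coe_insert]; exact hZ.insert hx)
        (by rwa [Finset.union_insert, ← Finset.insert_union]) (mem_facetKernel_contract hf)
        fun B hB => ?_
      rw [Finset.union_insert, ← Finset.insert_union]
      exact hv _ (hB.insert_of_contract hmin hxZ hAZ)
    obtain ⟨g, hfg, hg⟩ := exists_sub_affForm_mul_mem hx hf hf_contract
    have mult_pos : ∀ H, IsRelFacet X A Z H → 1 ≤ relFacetMult X A H := fun H hH =>
      relFacetMult_pos hH.finrank_add_one hAZ hH.vecSpan_le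
    have hg_delete : g ∈ realVanishingIdeal (affFlat X lam Z) :=
      ih hZ hAZ (mem_facetKernel_delete hxA hx mult_pos hg) fun B hB v hvB =>
        eval_eq_zero_of_sub_affForm_mul_mem hlam hxA hxZ hB hvB (hv B (hB.mono_insert x) v hvB) hfg
    exact (Submodule.sub_mem_iff_left _ (Ideal.mul_mem_left _ _ hg_delete)).1 hfg

theorem eq_zero_of_eval_internalVertices_eq_zero [Fintype ι]
    (hX : Submodule.span ℝ (Set.range X) = ⊤) (hlam : IsGeneric X lam) {f : Poly n}
    (hf : f ∈ internalP X) (hv : ∀ v ∈ internalVertices X lam, eval (complexPoint v) f = 0) :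
    f = 0 := by
  rw [internalP_eq_idealPerp hX, mem_idealPerp_internalI_iff_facetKernel lam] at hf
  have mem_ideal := mem_realVanishingIdeal_of_eval_vertices_eq_zero hlam (by simp)
    (by rw [Finset.union_empty, vecSpan_univ, hX]) hf fun B hB v hvB =>
      hv v ⟨B, isRelInternalBasis_univ_iff.1 hB, by rwa [Finset.union_empty] at hvB⟩
  rwa [affFlat_empty, realVanishingIdeal_univ, Submodule.mem_bot] at mem_ideal

end InternalVertices

section Expansion

variable {n : ℕ} {ι : Type*} {V : ι → Finset ι} {Y : Finset ι} {r : ι → ℕ}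

theorem sum_image_lt_of_ne [DecidableEq ι] (hdisj : (Y : Set ι).PairwiseDisjoint V)
    (hlt : ∀ j ∈ Y, ∀ b ∈ V j, b ≠ j → r b < r j) {φ : Y → ι} (hφ : ∀ j : Y, φ j ∈ V j)
    (hne : φ ≠ Subtype.val) :
    ∑ b ∈ Finset.univ.image φ, r b < ∑ j ∈ Y, r j ∧ Function.Injective φ := by
  have hinj : Function.Injective φ := fun i j hij => Subtype.ext <|
    hdisj.elim_finset i.2 j.2 (φ i) (hφ i) (hij ▸ hφ j)
  refine ⟨?_, hinj⟩
  obtain ⟨i, hi⟩ := Function.ne_iff.1 hne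
  rw [Finset.sum_image hinj.injOn, ← Finset.sum_coe_sort Y]
  refine Finset.sum_lt_sum (fun j _ => ?_) ⟨i, Finset.mem_univ i, hlt i i.2 _ (hφ i) hi⟩
  by_cases hj : φ j = j
  · rw [hj]
  · exact (hlt j j.2 _ (hφ j) hj).le

/-- Each other term of the expanded product picks one vector from every `V j`. -/
theorem prod_linForm_sub_prodForm_mem (X : ι → Fin n → ℝ) {c : ι → ι → ℝ}
    (hdisj : (Y : Set ι).PairwiseDisjoint V) (hlt : ∀ j ∈ Y, ∀ b ∈ V j, b ≠ j → r b < r j)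
    (hmem : ∀ j ∈ Y, j ∈ V j) (hc : ∀ j ∈ Y, c j j = 1) :
    (∏ j ∈ Y, linForm (∑ b ∈ V j, c j b • X b)) - prodForm X Y ∈
      Submodule.span ℂ {p : Poly n | ∃ T, ∑ j ∈ T, r j < ∑ j ∈ Y, r j ∧ p = prodForm X T} := by
  classical
  have expand : ∏ j ∈ Y, linForm (∑ b ∈ V j, c j b • X b) =
      ∑ φ ∈ Fintype.piFinset fun j : Y => V j,
        ∏ j : Y, (c j (φ j) : ℂ) • linForm (X (φ j)) := by
    rw [← Finset.prod_univ_sum (fun j : Y => V j)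
      fun j b => (c j b : ℂ) • (linForm (X b) : Poly n), ← Finset.prod_coe_sort Y]
    refine Finset.prod_congr rfl fun j _ => ?_
    exact (map_sum linFormHom _ _).trans (Finset.sum_congr rfl fun b _ => map_smul linFormHom _ _)
  have val_mem : (Subtype.val : Y → ι) ∈ Fintype.piFinset fun j : Y => V j :=
    Fintype.mem_piFinset.2 fun j => hmem j j.2
  have val_term : ∏ j : Y, (c (j : ι) j : ℂ) • linForm (X j) = prodForm X Y := by
    rw [prodForm, ← Finset.prod_coe_sort Y]
    exact Finset.prod_congr rfl fun j _ => by rw [hc j j.2, Complex.ofReal_one, one_smul]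
  rw [expand, ← Finset.add_sum_erase _ _ val_mem, val_term, add_sub_cancel_left]
  refine sum_mem fun φ hφ => ?_
  obtain ⟨hne, hφ⟩ := Finset.mem_erase.1 hφ
  obtain ⟨hsum, hinj⟩ := sum_image_lt_of_ne hdisj hlt (Fintype.mem_piFinset.1 hφ) hne
  rw [Finset.prod_smul]
  refine Submodule.smul_mem _ _ (Submodule.subset_span ⟨_, hsum, ?_⟩)
  rw [prodForm, Finset.prod_image hinj.injOn]

end Expansion

section Coordinates

variable {n : ℕ} {ι : Type*} {X : ι → Fin n → ℝ} {B : Finset ι}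

theorem IsBasis.exists_coords (hB : IsBasis X B) :
    ∃ a : ι → ι → ℝ, (∀ j, X j = ∑ b ∈ B, a j b • X b) ∧
      ∀ b ∈ B, ∀ c ∈ B, c ≠ b → a c b = 0 := by
  classical
  refine ⟨fun j b => if hb : b ∈ B then hB.basis.repr (X j) ⟨b, hb⟩ else 0, fun j => ?_,
    fun b hb c hc hcb => ?_⟩
  · conv_lhs => rw [← hB.basis.sum_repr (X j)]
    rw [← Finset.sum_coe_sort B]
    refine Finset.sum_congr rfl fun b _ => ?_
    simp only [dif_pos b.2, hB.basis_apply]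
  · simp only [dif_pos hb]
    rw [← hB.basis_apply ⟨c, hc⟩, Module.Basis.repr_self, Finsupp.single_eq_of_ne]
    exact fun h => hcb (congrArg Subtype.val h).symm

variable [LinearOrder ι]

theorem exists_lt_notMem_vecSpan_erase (hB : B ∈ internalBases X) {b : ι} (hb : b ∈ B) :
    ∃ j, b < j ∧ X j ∉ vecSpan X (B.erase b) := by
  have hbB : X b ∉ vecSpan X (B.erase b) := by
    have hind := hB.1.1
    rw [← Finset.insert_erase hb, Finset.coe_insert,
      linearIndepOn_insert (by simp)] at hind
    exact hind.2
  by_contra! h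
  exact hB.2 b hb ⟨hbB, fun j hj => not_lt.1 fun hbj => hj (h j hbj)⟩

theorem exists_greatest_coord [Finite ι] (hB : B ∈ internalBases X) {a : ι → ι → ℝ}
    (ha : ∀ j, X j = ∑ b ∈ B, a j b • X b) {b : ι} (hb : b ∈ B) :
    ∃ y, b < y ∧ IsGreatest {j | a j b ≠ 0} y := by
  obtain ⟨j, hbj, hj⟩ := exists_lt_notMem_vecSpan_erase hB hb
  have hjb : a j b ≠ 0 := by
    intro hjb
    refine hj ?_
    rw [ha j, ← Finset.add_sum_erase _ _ hb, hjb, zero_smul, zero_add]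
    exact sum_mem fun i hi => Submodule.smul_mem _ _ (mem_vecSpan hi)
  obtain ⟨y, hy, le_y⟩ := Set.exists_max_image {j | a j b ≠ 0} id (Set.toFinite _) ⟨j, hjb⟩
  exact ⟨y, hbj.trans_le (le_y j hjb), hy, le_y⟩

end Coordinates

section OffHyperplane

variable {n : ℕ} {ι : Type*} {η : Fin n → ℝ} {q : ι → Fin n → ℝ} {S : Finset ι} {j : ι}

/-- The indices in `S` of the vectors `q j` outside the hyperplane with normal `η`. -/
noncomputable def offHyperplane (η : Fin n → ℝ) (q : ι → Fin n → ℝ) (S : Finset ι) : Finset ι :=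
  S.filter fun j => η ⬝ᵥ q j ≠ 0

theorem mem_offHyperplane : j ∈ offHyperplane η q S ↔ j ∈ S ∧ η ⬝ᵥ q j ≠ 0 :=
  Finset.mem_filter

theorem notMem_offHyperplane (hj : j ∈ S) : j ∉ offHyperplane η q S ↔ η ⬝ᵥ q j = 0 := by
  rw [mem_offHyperplane, not_and_not_right, forall_prop_of_true hj]

theorem card_offHyperplane_union [DecidableEq ι] {T : Finset ι} (h : Disjoint S T) :
    (offHyperplane η q (S ∪ T)).card = (offHyperplane η q S).card + (offHyperplane η q T).card := by
  rw [offHyperplane, Finset.filter_union,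
    Finset.card_union_of_disjoint (Finset.disjoint_filter_filter h)]
  rfl

end OffHyperplane

/-! ### Straightening products of linear forms -/

section Straightening

variable {n : ℕ} {ι : Type*} [LinearOrder ι] {X : ι → Fin n → ℝ} {Y : Finset ι}
  {η : Fin n → ℝ}

/-- A basis `base ⊆ X \ Y` with the coordinates of all vectors of `X`, such that for each basis
vector `b` the last vector `top b` with a nonzero `b`-coordinate comes after `b`.  It serves to
straighten the product `p_Y`. -/
structure Straightening (X : ι → Fin n → ℝ) (Y : Finset ι) where
  base : Finset ι
  isBasis : IsBasis X base
  notMem_of_mem_base : ∀ b ∈ base, b ∉ Y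
  coord : ι → ι → ℝ
  sum_coord : ∀ j, X j = ∑ b ∈ base, coord j b • X b
  coord_of_ne : ∀ b ∈ base, ∀ c ∈ base, c ≠ b → coord c b = 0
  top : ι → ι
  lt_top : ∀ b ∈ base, b < top b
  coord_top_ne_zero : ∀ b ∈ base, coord (top b) b ≠ 0
  le_top : ∀ b ∈ base, ∀ j, coord j b ≠ 0 → j ≤ top b

theorem exists_internalBasis_of_notMem_barelyLong (hY : Y ∉ barelyLong X) :
    ∃ B ∈ internalBases X, ∀ b ∈ B, b ∉ Y := by
  simp only [barelyLong, Set.mem_ofPred_eq, not_forall, Finset.not_nonempty_iff_eq_empty,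
    ← Finset.disjoint_iff_inter_eq_empty] at hY
  obtain ⟨B, hB, hYB⟩ := hY
  exact ⟨B, hB, fun _ hb => Finset.disjoint_right.1 hYB hb⟩

theorem nonempty_straightening [Finite ι] (hY : Y ∉ barelyLong X) :
    Nonempty (Straightening X Y) := by
  obtain ⟨B, hB, hBY⟩ := exists_internalBasis_of_notMem_barelyLong hY
  obtain ⟨a, ha, ha_ne⟩ := hB.1.exists_coords
  choose! top lt_top htop using fun b => exists_greatest_coord hB ha (b := b)
  exact ⟨⟨B, hB.1, hBY, a, ha, ha_ne, top, lt_top, fun b hb => (htop b hb).1,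
    fun b hb j hj => (htop b hb).2 hj⟩⟩

namespace Straightening

open scoped Classical in
/-- The basis vectors that are coloops of `X \ Y`: no other vector of `X \ Y` has a nonzero
coordinate at them. -/
noncomputable def coloops (P : Straightening X Y) : Finset ι :=
  P.base.filter fun b => ∀ c ∉ Y, c ≠ b → P.coord c b = 0

/-- The coloops whose last occurrence is at `j`. -/
noncomputable def coloopsAt (P : Straightening X Y) (j : ι) : Finset ι :=
  P.coloops.filter fun b => P.top b = j

/-- The vector `X j` without its components at the coloops that end at `j`. -/
noncomputable def vec (P : Straightening X Y) (j : ι) : Fin n → ℝ :=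
  X j - ∑ b ∈ P.coloopsAt j, P.coord j b • X b

variable (P : Straightening X Y)

theorem mem_coloops {b : ι} :
    b ∈ P.coloops ↔ b ∈ P.base ∧ ∀ c ∉ Y, c ≠ b → P.coord c b = 0 := by
  classical exact Finset.mem_filter

theorem mem_coloopsAt {b j : ι} : b ∈ P.coloopsAt j ↔ b ∈ P.coloops ∧ P.top b = j :=
  Finset.mem_filter

theorem dotProduct_eq_sum_coord (η : Fin n → ℝ) (j : ι) :
    η ⬝ᵥ X j = ∑ b ∈ P.base, P.coord j b * (η ⬝ᵥ X b) := by
  conv_lhs => rw [P.sum_coord j]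
  simp only [dotProduct_sum, dotProduct_smul, smul_eq_mul]

theorem dotProduct_vec (η : Fin n → ℝ) (j : ι) :
    η ⬝ᵥ P.vec j = η ⬝ᵥ X j - ∑ b ∈ P.coloopsAt j, P.coord j b * (η ⬝ᵥ X b) := by
  simp only [vec, dotProduct_sub, dotProduct_sum, dotProduct_smul, smul_eq_mul]

theorem top_mem {b : ι} (hb : b ∈ P.coloops) : P.top b ∈ Y := by
  obtain ⟨hb_base, hb_coloop⟩ := P.mem_coloops.1 hb
  by_contra h
  exact P.coord_top_ne_zero b hb_base (hb_coloop _ h (P.lt_top b hb_base).ne')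

theorem offHyperplane_vec_subset :
    offHyperplane η P.vec Y ⊆
      offHyperplane η X Y ∪ (offHyperplane η X P.coloops).image P.top := by
  intro j hj
  obtain ⟨hjY, hj⟩ := mem_offHyperplane.1 hj
  contrapose! hj
  obtain ⟨hjX, hj_top⟩ := not_or.1 (mt Finset.mem_union.2 hj)
  rw [P.dotProduct_vec, (notMem_offHyperplane hjY).1 hjX, zero_sub, neg_eq_zero]
  refine Finset.sum_eq_zero fun b hb => ?_
  obtain ⟨hbL, rfl⟩ := P.mem_coloopsAt.1 hb
  rw [(notMem_offHyperplane hbL).1 fun h => hj_top (Finset.mem_image_of_mem _ h), mul_zero]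

/-- If `e` were the only one, then `e` would be a basis vector and all other vectors of `X \ Y`
would have zero `e`-coordinate, so that `e` would be a coloop. -/
theorem card_offHyperplane_sdiff_coloops_ne_one [Fintype ι] :
    (offHyperplane η X (Yᶜ \ P.coloops)).card ≠ 1 := by
  intro hcard
  obtain ⟨e, he⟩ := Finset.card_eq_one.1 hcard
  have mem_iff : ∀ c, c ∉ Y → c ∉ P.coloops → (η ⬝ᵥ X c ≠ 0 ↔ c = e) := by
    intro c hcY hcL
    rw [← Finset.mem_singleton, ← he, mem_offHyperplane]
    simp [hcY, hcL]
  have he_mem : e ∈ offHyperplane η X (Yᶜ \ P.coloops) := he ▸ Finset.mem_singleton_self e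
  simp only [mem_offHyperplane, Finset.mem_sdiff, Finset.mem_compl] at he_mem
  obtain ⟨⟨heY, heL⟩, he_ne⟩ := he_mem
  have dot_eq : ∀ c, c ∉ Y → c ∉ P.coloops →
      η ⬝ᵥ X c = ∑ b ∈ P.base, if b = e then P.coord c b * (η ⬝ᵥ X b) else 0 := by
    intro c hcY hcL
    rw [P.dotProduct_eq_sum_coord η c]
    refine Finset.sum_congr rfl fun b hb => ?_
    split_ifs with hbe
    · rfl
    by_cases hbL : b ∈ P.coloops
    · rw [(P.mem_coloops.1 hbL).2 c hcY fun h => hcL (h ▸ hbL), zero_mul]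
    · rw [not_not.1 (mt (mem_iff b (P.notMem_of_mem_base b hb) hbL).1 hbe), mul_zero]
  simp only [Finset.sum_ite_eq'] at dot_eq
  have he_base : e ∈ P.base := by
    by_contra h
    exact he_ne (by rw [dot_eq e heY heL, if_neg h])
  refine heL (P.mem_coloops.2 ⟨he_base, fun c hcY hce => ?_⟩)
  by_cases hcL : c ∈ P.coloops
  · exact P.coord_of_ne e he_base c (P.mem_coloops.1 hcL).1 hce
  · have hc := dot_eq c hcY hcL
    rw [if_pos he_base, not_not.1 (mt (mem_iff c hcY hcL).1 hce)] at hc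
    exact (mul_eq_zero.1 hc.symm).resolve_right he_ne

theorem dotProduct_eq_zero_of_notMem_coloops [Fintype ι]
    (hE : offHyperplane η X (Yᶜ \ P.coloops) = ∅) {c : ι} (hcY : c ∉ Y) (hcL : c ∉ P.coloops) :
    η ⬝ᵥ X c = 0 :=
  (notMem_offHyperplane (by simp [hcY, hcL])).1 (hE ▸ Finset.notMem_empty c)

section Last

variable [Fintype ι] (hE : offHyperplane η X (Yᶜ \ P.coloops) = ∅) {b₀ : ι}
  (hb₀ : b₀ ∈ offHyperplane η X P.coloops)
  (hmax : ∀ b ∈ offHyperplane η X P.coloops, P.top b ≤ P.top b₀)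
include hE hmax

theorem top_eq_of_coord_mul_ne_zero {b : ι} (hb : b ∈ P.base)
    (hne : P.coord (P.top b₀) b * (η ⬝ᵥ X b) ≠ 0) :
    b ∈ offHyperplane η X P.coloops ∧ P.top b = P.top b₀ := by
  have hb_dot := right_ne_zero_of_mul hne
  have hbL : b ∈ P.coloops := by
    by_contra h
    exact hb_dot (P.dotProduct_eq_zero_of_notMem_coloops hE (P.notMem_of_mem_base b hb) h)
  have hb_mem := mem_offHyperplane.2 ⟨hbL, hb_dot⟩
  exact ⟨hb_mem, le_antisymm (hmax b hb_mem) (P.le_top b hb _ (left_ne_zero_of_mul hne))⟩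

theorem dotProduct_vec_top_eq_zero : η ⬝ᵥ P.vec (P.top b₀) = 0 := by
  rw [P.dotProduct_vec, sub_eq_zero, P.dotProduct_eq_sum_coord]
  refine (Finset.sum_subset (fun b hb => (P.mem_coloops.1 (P.mem_coloopsAt.1 hb).1).1)
    fun b hb hb_notMem => ?_).symm
  by_contra hne
  obtain ⟨hb_mem, hb_top⟩ := P.top_eq_of_coord_mul_ne_zero hE hmax hb hne
  exact hb_notMem (P.mem_coloopsAt.2 ⟨(mem_offHyperplane.1 hb_mem).1, hb_top⟩)

include hb₀

theorem not_injOn_top_of_dotProduct_eq_zero (hdot : η ⬝ᵥ X (P.top b₀) = 0) :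
    ¬ Set.InjOn P.top (offHyperplane η X P.coloops) := by
  intro hinj
  obtain ⟨hb₀L, hb₀_dot⟩ := mem_offHyperplane.1 hb₀
  have hb₀_base := (P.mem_coloops.1 hb₀L).1
  rw [P.dotProduct_eq_sum_coord, Finset.sum_eq_single_of_mem b₀ hb₀_base] at hdot
  · exact mul_ne_zero (P.coord_top_ne_zero b₀ hb₀_base) hb₀_dot hdot
  · intro b hb hbb
    by_contra hne
    obtain ⟨hb_mem, hb_top⟩ := P.top_eq_of_coord_mul_ne_zero hE hmax hb hne
    exact hbb (hinj hb_mem hb₀ hb_top)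

/-- The index `m = top b₀` is lost on the left-hand side.  Either it also counts on the right-hand
side, in addition to `b₀`, or two of the coloops end at `m`. -/
theorem card_offHyperplane_vec_add_two_le_of_last :
    (offHyperplane η P.vec Y).card + 2 ≤
      (offHyperplane η X Y).card + (offHyperplane η X P.coloops).card := by
  have hm_mem := Finset.mem_image_of_mem P.top hb₀
  have hm_notMem : P.top b₀ ∉ offHyperplane η P.vec Y := fun h =>
    (mem_offHyperplane.1 h).2 (P.dotProduct_vec_top_eq_zero hE hmax)
  have hsub := (Finset.subset_erase.2 ⟨P.offHyperplane_vec_subset, hm_notMem⟩)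
  rw [Finset.erase_union_distrib] at hsub
  have hcard := (Finset.card_le_card hsub).trans (Finset.card_union_le _ _)
  rw [Finset.card_erase_of_mem hm_mem] at hcard
  have image_pos := Finset.card_pos.2 ⟨_, hm_mem⟩
  have image_le : ((offHyperplane η X P.coloops).image P.top).card ≤ _ := Finset.card_image_le
  by_cases hm : P.top b₀ ∈ offHyperplane η X Y
  · rw [Finset.card_erase_of_mem hm] at hcard
    have := Finset.card_pos.2 ⟨_, hm⟩
    omega
  · rw [Finset.erase_eq_of_notMem hm] at hcard
    have hdot := (notMem_offHyperplane (P.top_mem (mem_offHyperplane.1 hb₀).1)).1 hm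
    have image_ne := mt Finset.card_image_iff.1
      (P.not_injOn_top_of_dotProduct_eq_zero hE hb₀ hmax hdot)
    omega

end Last

theorem offHyperplane_coloops_nonempty [Fintype ι] (hη : η ≠ 0)
    (hE : offHyperplane η X (Yᶜ \ P.coloops) = ∅) :
    (offHyperplane η X P.coloops).Nonempty := by
  contrapose! hη
  refine eq_zero_of_forall_dotProduct P.isBasis.2 (Set.forall_mem_image.2 fun b hb => ?_)
  by_cases hbL : b ∈ P.coloops
  · exact (notMem_offHyperplane hbL).1 (hη ▸ Finset.notMem_empty b)
  · exact P.dotProduct_eq_zero_of_notMem_coloops hE (P.notMem_of_mem_base b hb) hbL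

theorem card_offHyperplane_univ [Fintype ι] :
    (offHyperplane η X Finset.univ).card = (offHyperplane η X Y).card +
      ((offHyperplane η X P.coloops).card + (offHyperplane η X (Yᶜ \ P.coloops)).card) := by
  have coloops_subset : P.coloops ⊆ Yᶜ := fun b hb =>
    Finset.mem_compl.2 (P.notMem_of_mem_base b (P.mem_coloops.1 hb).1)
  rw [← card_offHyperplane_union Finset.disjoint_sdiff, Finset.union_sdiff_of_subset coloops_subset,
    ← card_offHyperplane_union disjoint_compl_right, Finset.union_compl]

theorem card_offHyperplane_vec_add_two_le [Fintype ι] (hη : η ≠ 0) :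
    (offHyperplane η P.vec Y).card + 2 ≤ (offHyperplane η X Finset.univ).card := by
  rw [P.card_offHyperplane_univ]
  rcases (offHyperplane η X (Yᶜ \ P.coloops)).eq_empty_or_nonempty with hE | hE
  · obtain ⟨b₀, hb₀, hmax⟩ :=
      Finset.exists_max_image _ P.top (P.offHyperplane_coloops_nonempty hη hE)
    have := P.card_offHyperplane_vec_add_two_le_of_last hE hb₀ hmax
    omega
  · have hcard := (Finset.card_le_card P.offHyperplane_vec_subset).trans
      (Finset.card_union_le (offHyperplane η X Y) _)
    have image_le : ((offHyperplane η X P.coloops).image P.top).card ≤ _ := Finset.card_image_le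
    have := P.card_offHyperplane_sdiff_coloops_ne_one (η := η)
    have := hE.card_pos
    omega

theorem prod_linForm_vec_sub_prodForm_mem {r : ι → ℕ}
    (hr : StrictMono r) : (∏ j ∈ Y, linForm (P.vec j)) - prodForm X Y ∈
      Submodule.span ℂ {p : Poly n | ∃ T, ∑ j ∈ T, r j < ∑ j ∈ Y, r j ∧ p = prodForm X T} := by
  have notMem_Y : ∀ {j b}, b ∈ P.coloopsAt j → b ∉ Y := fun hb =>
    P.notMem_of_mem_base _ (P.mem_coloops.1 (P.mem_coloopsAt.1 hb).1).1
  have vec_eq : ∀ j ∈ Y, P.vec j =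
      ∑ b ∈ insert j (P.coloopsAt j), (if b = j then 1 else -P.coord j b) • X b := by
    intro j hj
    rw [Finset.sum_insert fun h => notMem_Y h hj, if_pos rfl, one_smul, vec, sub_eq_add_neg,
      ← Finset.sum_neg_distrib]
    refine congrArg _ (Finset.sum_congr rfl fun b hb => ?_)
    rw [if_neg fun h : b = j => notMem_Y hb (h ▸ hj), neg_smul]
  rw [Finset.prod_congr rfl fun j hj => congrArg linForm (vec_eq j hj)]
  refine prod_linForm_sub_prodForm_mem X (fun i hi j hj hij => ?_) (fun j hj b hb hbj => ?_)
    (fun j _ => Finset.mem_insert_self _ _) fun j _ => if_pos rfl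
  · refine Finset.disjoint_left.2 fun b hbi hbj => hij ?_
    rcases Finset.mem_insert.1 hbi with rfl | hbi <;> rcases Finset.mem_insert.1 hbj with rfl | hbj
    · rfl
    · exact absurd hi (notMem_Y hbj)
    · exact absurd hj (notMem_Y hbi)
    · exact (P.mem_coloopsAt.1 hbi).2.symm.trans (P.mem_coloopsAt.1 hbj).2
  · obtain ⟨hbL, rfl⟩ := P.mem_coloopsAt.1 (Finset.mem_of_mem_insert_of_ne hb hbj)
    exact hr (P.lt_top b (P.mem_coloops.1 hbL).1)

end Straightening

end Straightening

section SpanProdForm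

variable {n : ℕ} {ι : Type*} [LinearOrder ι] {X : ι → Fin n → ℝ}

theorem eq_top_of_linForm_mul_mem {M : Submodule ℂ (Poly n)} (one_mem : 1 ∈ M)
    (mul_mem : ∀ x, ∀ p ∈ M, linForm x * p ∈ M) : M = ⊤ := by
  refine Submodule.eq_top_iff'.2 fun p => ?_
  induction p using MvPolynomial.induction_on with
  | C c =>
    rw [← mul_one (C c), ← smul_eq_C_mul]
    exact M.smul_mem c one_mem
  | add p q hp hq => exact add_mem hp hq
  | mul_X p i hp =>
    rw [mul_comm, ← linForm_single]
    exact mul_mem _ p hp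

/-- If `Y` misses the internal basis `B`, write `x` in terms of `B`. -/
theorem linForm_mul_prodForm_mem (x : Fin n → ℝ) (Y : Finset ι) :
    linForm x * prodForm X Y ∈
      Submodule.span ℂ (Set.range (prodForm X)) ⊔ (internalJ X).restrictScalars ℂ := by
  by_cases hY : Y ∈ barelyLong X
  · exact Submodule.mem_sup_right
      (Ideal.mul_mem_left (internalJ X) _ (Ideal.subset_span ⟨Y, hY, rfl⟩))
  obtain ⟨B, hB, hBY⟩ := exists_internalBasis_of_notMem_barelyLong hY
  have linForm_mem : linForm x ∈ Submodule.span ℂ (linForm '' (X '' (B : Set ι))) :=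
    linForm_mem_span_of_mem_span (hB.1.2 ▸ Submodule.mem_top)
  refine Submodule.mem_sup_left (Submodule.span_le (p := (Submodule.span ℂ
    (Set.range (prodForm X))).comap (LinearMap.mulRight ℂ (prodForm X Y))).2 ?_ linForm_mem)
  rintro _ ⟨_, ⟨b, hb, rfl⟩, rfl⟩
  exact Submodule.subset_span ⟨insert b Y, prodForm_insert X (hBY b hb)⟩

theorem span_prodForm_sup_internalJ (X : ι → Fin n → ℝ) :
    Submodule.span ℂ (Set.range (prodForm X)) ⊔ (internalJ X).restrictScalars ℂ = ⊤ := by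
  refine eq_top_of_linForm_mul_mem
    (Submodule.mem_sup_left (Submodule.subset_span ⟨∅, prodForm_empty X⟩)) fun x p hp => ?_
  have sup_le_comap : Submodule.span ℂ (Set.range (prodForm X)) ⊔
      (internalJ X).restrictScalars ℂ ≤ (Submodule.span ℂ (Set.range (prodForm X)) ⊔
        (internalJ X).restrictScalars ℂ).comap (LinearMap.mulLeft ℂ (linForm x)) := by
    refine sup_le (Submodule.span_le.2 ?_) fun q hq => ?_
    · rintro _ ⟨Y, rfl⟩
      exact linForm_mul_prodForm_mem x Y
    · exact Submodule.mem_sup_right ((internalJ X).mul_mem_left _ hq)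
  exact sup_le_comap hp

end SpanProdForm

section Spanning

variable {n : ℕ} {ι : Type*} [Fintype ι] {X : ι → Fin n → ℝ} {Y : Finset ι}

theorem facetMult_eq_card_offHyperplane {H : Submodule ℝ (Fin n → ℝ)} {η : Fin n → ℝ}
    (hH : IsFacetHyperplane X H) (hη : IsNormal H η) :
    facetMult X H = (offHyperplane η X Finset.univ).card := by
  rw [facetMult, ← Set.ncard_coe_finset]
  congr 1
  ext i
  rw [Set.mem_ofPred_eq, Finset.mem_coe, mem_offHyperplane]
  exact ⟨fun hi => ⟨Finset.mem_univ i, hη.dotProduct_ne_zero hH.1 hi⟩,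
    fun h hi => h.2 (hη.dotProduct_eq_zero _ hi)⟩

theorem prod_linForm_mem_internalP [DecidableEq ι] (hX : Submodule.span ℝ (Set.range X) = ⊤)
    {q : ι → Fin n → ℝ} (hq : ∀ η : Fin n → ℝ, η ≠ 0 →
      (offHyperplane η q Y).card + 2 ≤ (offHyperplane η X Finset.univ).card) :
    ∏ j ∈ Y, linForm (q j) ∈ internalP X := by
  rw [internalP_eq_idealPerp hX, mem_idealPerp_internalI]
  intro H η hH hη_ne hη
  have := hq η hη_ne
  rw [facetMult_eq_card_offHyperplane hH ⟨hη_ne, hη⟩]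
  exact dirDeriv_iterate_prod_linForm_eq_zero η q Y (by rw [← offHyperplane]; omega)

variable [LinearOrder ι]

theorem Straightening.prod_linForm_vec_mem_internalP (P : Straightening X Y)
    (hX : Submodule.span ℝ (Set.range X) = ⊤) : ∏ j ∈ Y, linForm (P.vec j) ∈ internalP X :=
  prod_linForm_mem_internalP hX fun _ hη => P.card_offHyperplane_vec_add_two_le hη

theorem prodForm_mem_internalP_sup_internalJ (hX : Submodule.span ℝ (Set.range X) = ⊤)
    (Y : Finset ι) : prodForm X Y ∈ internalP X ⊔ (internalJ X).restrictScalars ℂ := by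
  set r := (Fintype.orderIsoFinOfCardEq ι rfl).symm
  have hr : StrictMono fun i => (r i : ℕ) := Fin.val_strictMono.comp r.strictMono
  induction hw : ∑ j ∈ Y, (r j : ℕ) using Nat.strong_induction_on generalizing Y with
  | _ w ih =>
  by_cases hY : Y ∈ barelyLong X
  · exact Submodule.mem_sup_right (Ideal.subset_span ⟨Y, hY, rfl⟩)
  obtain ⟨P⟩ := nonempty_straightening hY
  have span_le : Submodule.span ℂ {p : Poly n | ∃ T, ∑ j ∈ T, (r j : ℕ) < ∑ j ∈ Y, (r j : ℕ) ∧
      p = prodForm X T} ≤ internalP X ⊔ (internalJ X).restrictScalars ℂ :=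
    Submodule.span_le.2 fun _ ⟨T, hT, hp⟩ => hp ▸ ih _ (hw ▸ hT) T rfl
  have hprod := Submodule.mem_sup_left (T := (internalJ X).restrictScalars ℂ)
    (P.prod_linForm_vec_mem_internalP hX)
  exact (Submodule.sub_mem_iff_right _ hprod).1
    (span_le (P.prod_linForm_vec_sub_prodForm_mem hr))

theorem internalP_sup_internalJ (hX : Submodule.span ℝ (Set.range X) = ⊤) :
    internalP X ⊔ (internalJ X).restrictScalars ℂ = ⊤ := by
  rw [eq_top_iff, ← span_prodForm_sup_internalJ X]
  refine sup_le (Submodule.span_le.2 ?_) le_sup_right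
  rintro _ ⟨Y, rfl⟩
  exact prodForm_mem_internalP_sup_internalJ hX Y

end Spanning

/-! ### The varieties of the two ideals -/

section Variety

variable {n : ℕ} {ι : Type*} {X : ι → Fin n → ℝ} {B : Finset ι}

theorem eq_zero_of_eval_linForm_eq_zero {s : Set (Fin n → ℝ)} (hs : Submodule.span ℝ s = ⊤)
    {θ : Fin n → ℂ} (h : ∀ x ∈ s, eval θ (linForm x) = 0) : θ = 0 := by
  have span_le_ker : Submodule.span ℂ (linForm '' s) ≤
      LinearMap.ker (aeval θ : Poly n →ₐ[ℂ] ℂ).toLinearMap :=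
    Submodule.span_le.2 (Set.forall_mem_image.2 h)
  funext i
  have X_mem : (X i : Poly n) ∈ Submodule.span ℂ (linForm '' s) :=
    linForm_single i ▸ linForm_mem_span_of_mem_span (hs ▸ Submodule.mem_top)
  simpa using span_le_ker X_mem

theorem variety_internalJ_subset [Finite ι] [LinearOrder ι] (X : ι → Fin n → ℝ) :
    variety (internalJ X) ⊆ {0} := by
  classical
  cases nonempty_fintype ι
  intro θ hθ
  have nonvanishing_notMem :
      (Finset.univ.filter fun i => eval θ (linForm (X i)) ≠ 0) ∉ barelyLong X := by
    intro hY
    have eval_prodForm := hθ _ (Ideal.subset_span ⟨_, hY, rfl⟩)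
    rw [prodForm, map_prod, Finset.prod_eq_zero_iff] at eval_prodForm
    obtain ⟨i, hi, eval_eq_zero⟩ := eval_prodForm
    exact (Finset.mem_filter.1 hi).2 eval_eq_zero
  obtain ⟨B, hB, hBY⟩ := exists_internalBasis_of_notMem_barelyLong nonvanishing_notMem
  exact eq_zero_of_eval_linForm_eq_zero hB.1.2 <| Set.forall_mem_image.2 fun b hb => by
    simpa using hBY b hb

theorem exists_isBasis [Finite ι] (hX : Submodule.span ℝ (Set.range X) = ⊤) :
    ∃ B : Finset ι, IsBasis X B := by
  obtain ⟨b, -, -, range_subset, hb⟩ := exists_linearIndepOn_extension (K := ℝ) (v := X)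
    (linearIndepOn_empty ℝ X) (Set.empty_subset Set.univ)
  refine ⟨(Set.toFinite b).toFinset, by simpa using hb, ?_⟩
  rw [Set.Finite.coe_toFinset, eq_top_iff, ← hX, Submodule.span_le, ← Set.image_univ]
  exact range_subset

theorem IsBasis.isFacetHyperplane_vecSpan_erase [DecidableEq ι] (hB : IsBasis X B) {b : ι}
    (hb : b ∈ B) : IsFacetHyperplane X (vecSpan X (B.erase b)) := by
  have hind := hB.1
  rw [← Finset.insert_erase hb, Finset.coe_insert, linearIndepOn_insert (by simp)] at hind
  refine ⟨finrank_add_one_eq (x := X b) (fun h => hind.2 (h.ge Submodule.mem_top)) ?_,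
    le_antisymm (Submodule.span_le.2 Set.inter_subset_right) (Submodule.span_mono ?_)⟩
  · rw [← vecSpan_insert, Finset.insert_erase hb, vecSpan, hB.2]
  · rintro _ ⟨i, hi, rfl⟩
    exact ⟨⟨i, rfl⟩, mem_vecSpan hi⟩

theorem IsBasis.eq_zero_of_forall_mem_vecSpan_erase [DecidableEq ι] (hB : IsBasis X B)
    {x : Fin n → ℝ} (hx : ∀ b ∈ B, x ∈ vecSpan X (B.erase b)) : x = 0 := by
  refine hB.basis.ext_elem fun b => ?_
  have vecSpan_le_ker : vecSpan X (B.erase b) ≤ LinearMap.ker (hB.basis.coord b) := by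
    refine vecSpan_le.2 fun i hi => ?_
    obtain ⟨hib, hiB⟩ := Finset.mem_erase.1 hi
    rw [LinearMap.mem_ker, Module.Basis.coord_apply, ← hB.basis_apply ⟨i, hiB⟩,
      Module.Basis.repr_self, Finsupp.single_eq_of_ne fun h => hib (congrArg Subtype.val h).symm]
  rw [map_zero]
  exact vecSpan_le_ker (hx b b.2)

theorem span_facet_normals [Finite ι] (hX : Submodule.span ℝ (Set.range X) = ⊤) :
    Submodule.span ℝ {η | ∃ H, IsFacetHyperplane X H ∧ IsNormal H η} = ⊤ := by
  classical
  by_contra hne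
  obtain ⟨x, hx⟩ := exists_isNormal hne
  obtain ⟨B, hB⟩ := exists_isBasis hX
  refine hx.ne_zero (hB.eq_zero_of_forall_mem_vecSpan_erase fun b hb => ?_)
  by_contra hxb
  have hH := hB.isFacetHyperplane_vecSpan_erase hb
  obtain ⟨η, hη⟩ := exists_isNormal fun h : vecSpan X (B.erase b) = ⊤ =>
    hxb (h.ge Submodule.mem_top)
  refine hη.dotProduct_ne_zero hH.1 hxb ?_
  rw [dotProduct_comm]
  exact hx.dotProduct_eq_zero η (Submodule.subset_span ⟨_, hH, hη⟩)

theorem variety_internalI_subset [Finite ι] (hX : Submodule.span ℝ (Set.range X) = ⊤) :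
    variety (internalI X) ⊆ {0} := by
  refine fun θ hθ => eq_zero_of_eval_linForm_eq_zero (span_facet_normals hX) ?_
  rintro η ⟨H, hH, hη⟩
  have eval_pow := hθ _ (Ideal.subset_span ⟨H, η, hH, hη.ne_zero, hη.dotProduct_eq_zero, rfl⟩)
  rw [map_pow] at eval_pow
  exact eq_zero_of_pow_eq_zero eval_pow

theorem map_internalD_eq_idealKer [Finite ι] [LinearOrder ι] (X : ι → Fin n → ℝ) :
    (internalD X).map (toSeries n) = idealKer (internalJ X) := by
  rw [internalD_eq_idealPerp, map_idealPerp_eq_idealKer (variety_internalJ_subset X)]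

theorem map_internalP_eq_idealKer [Fintype ι] [DecidableEq ι]
    (hX : Submodule.span ℝ (Set.range X) = ⊤) :
    (internalP X).map (toSeries n) = idealKer (internalI X) := by
  rw [internalP_eq_idealPerp hX, map_idealPerp_eq_idealKer (variety_internalI_subset hX)]

end Variety

/-! ### Existence of generic arrangements -/

section Generic

variable {n : ℕ} {ι : Type*} {X : ι → Fin n → ℝ} {lam : ι → ℝ} {B B' : Finset ι}
  {v : Fin n → ℝ}

/-- The `λ` for which the hyperplanes `x · t = λ_x` with index in `S` have a common point. -/
def concurrentSubspace (X : ι → Fin n → ℝ) (S : Finset ι) : Submodule ℝ (ι → ℝ) where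
  carrier := {lam | (affFlat X lam S).Nonempty}
  add_mem' := fun ⟨t, ht⟩ ⟨u, hu⟩ =>
    ⟨t + u, fun i hi => by rw [dotProduct_add, ht i hi, hu i hi, Pi.add_apply]⟩
  zero_mem' := ⟨0, fun i _ => dotProduct_zero (X i)⟩
  smul_mem' := fun c _ ⟨t, ht⟩ =>
    ⟨c • t, fun i hi => by rw [dotProduct_smul, ht i hi, Pi.smul_apply]⟩

theorem concurrentSubspace_ne_top (X : ι → Fin n → ℝ) {S : Finset ι} (hS : n < S.card) :
    concurrentSubspace X S ≠ ⊤ := by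
  intro htop
  have hsurj : Function.Surjective (Matrix.mulVecLin (Matrix.of fun i : S => X i)) := by
    intro g
    obtain ⟨t, ht⟩ : Function.extend Subtype.val g 0 ∈ concurrentSubspace X S :=
      htop ▸ Submodule.mem_top
    exact ⟨t, funext fun i => (ht i i.2).trans (Subtype.val_injective.extend_apply g 0 i)⟩
  have := LinearMap.finrank_le_finrank_of_surjective hsurj
  rw [Module.finrank_fintype_fun_eq_card, Module.finrank_fin_fun, Fintype.card_coe] at this
  omega

/-- A real vector space is not a finite union of proper subspaces. -/
theorem exists_isGeneric [Finite ι] (X : ι → Fin n → ℝ) : ∃ lam : ι → ℝ, IsGeneric X lam := by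
  classical
  cases nonempty_fintype ι
  let s := (Finset.univ.filter fun S : Finset ι => S.card = n + 1).image (concurrentSubspace X)
  have top_notMem : ⊤ ∉ s := by
    intro h
    obtain ⟨S, hS, htop⟩ := Finset.mem_image.1 h
    rw [Finset.mem_filter_univ] at hS
    exact concurrentSubspace_ne_top X (by omega) htop
  obtain ⟨lam, hlam⟩ := (Set.ne_univ_iff_exists_notMem _).1
    (Subspace.biUnion_ne_univ_of_top_notMem top_notMem)
  exact ⟨lam, fun S hS hconc => hlam (Set.mem_biUnion
    (Finset.mem_image_of_mem _ ((Finset.mem_filter_univ S).2 hS)) hconc)⟩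

theorem IsBasis.existsUnique_mem_affFlat (hB : IsBasis X B) (lam : ι → ℝ) :
    ∃! v, v ∈ affFlat X lam B := by
  obtain ⟨v, hv⟩ := exists_dotProduct_eq (hB.basis.constr ℝ fun i : B => lam i)
  have v_mem : v ∈ affFlat X lam B := fun i hi => by
    rw [hv, ← hB.basis_apply ⟨i, hi⟩, Module.Basis.constr_basis]
  refine ⟨v, v_mem, fun w hw => sub_eq_zero.1 ?_⟩
  refine eq_zero_of_forall_dotProduct hB.2 (Set.forall_mem_image.2 fun i hi => ?_)
  rw [dotProduct_comm, dotProduct_sub, hw i hi, v_mem i hi, sub_self]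

theorem IsGeneric.eq_of_mem_affFlat (hlam : IsGeneric X lam) (hB : IsBasis X B)
    (hB' : IsBasis X B') (hv : v ∈ affFlat X lam B) (hv' : v ∈ affFlat X lam B') : B = B' := by
  have subset : B' ⊆ B := fun i hi => by
    by_contra hiB
    exact hlam.dotProduct_ne hB hv hiB (hv' i hi)
  exact (Finset.eq_of_subset_of_card_le subset (by rw [hB.card_eq, hB'.card_eq])).symm

variable [LinearOrder ι]

theorem IsGeneric.exists_bijOn_internalVertices (hlam : IsGeneric X lam) :
    ∃ v : Finset ι → Fin n → ℝ, Set.BijOn v (internalBases X) (internalVertices X lam) := by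
  choose! v hv v_unique using fun (B : Finset ι) (hB : IsBasis X B) =>
    hB.existsUnique_mem_affFlat lam
  refine ⟨v, fun B hB => ⟨B, hB, hv B hB.1⟩, fun B hB B' hB' h => ?_, ?_⟩
  · exact hlam.eq_of_mem_affFlat hB.1 hB'.1 (hv B hB.1) (h ▸ hv B' hB'.1)
  · rintro w ⟨B, hB, hw⟩
    exact ⟨B, hB, (v_unique B hB.1 w hw).symm⟩

theorem IsGeneric.ncard_internalVertices (hlam : IsGeneric X lam) :
    (internalVertices X lam).ncard = (internalBases X).ncard := by
  obtain ⟨v, hv⟩ := hlam.exists_bijOn_internalVertices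
  exact hv.ncard_eq.symm

theorem IsGeneric.finite_internalVertices [Finite ι] (hlam : IsGeneric X lam) :
    (internalVertices X lam).Finite := by
  obtain ⟨v, hv⟩ := hlam.exists_bijOn_internalVertices
  exact hv.finite_iff_finite.1 (Set.toFinite _)

end Generic

/-! ### Leading forms and least terms -/

section LeadingForm

variable {σ R : Type*} [CommSemiring R]

theorem homogeneousComponent_add_mul {p q : MvPolynomial σ R} {j k : ℕ} (hp : p.totalDegree ≤ j)
    (hq : q.totalDegree ≤ k) : homogeneousComponent (j + k) (p * q) =
      homogeneousComponent j p * homogeneousComponent k q := by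
  classical
  have coeff_eq_zero {r : MvPolynomial σ R} {m : ℕ} (hr : r.totalDegree ≤ m) {b : σ →₀ ℕ}
      (hb : m < b.degree) : coeff b r = 0 :=
    coeff_eq_zero_of_totalDegree_lt (hr.trans_lt hb)
  ext b
  rw [coeff_homogeneousComponent]
  split_ifs with hb
  · simp only [coeff_mul, coeff_homogeneousComponent]
    refine Finset.sum_congr rfl fun x hx => ?_
    have degree_add : x.1.degree + x.2.degree = j + k := by
      rw [← map_add, Finset.HasAntidiagonal.mem_antidiagonal.1 hx, hb]
    rcases lt_trichotomy x.1.degree j with hlt | heq | hgt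
    · rw [coeff_eq_zero hq (b := x.2) (by omega), if_neg hlt.ne, mul_zero, zero_mul]
    · rw [if_pos heq, if_pos (by omega)]
    · rw [coeff_eq_zero hp hgt, if_neg hgt.ne', zero_mul, zero_mul]
  · exact (((homogeneousComponent_isHomogeneous j p).mul
      (homogeneousComponent_isHomogeneous k q)).coeff_eq_zero hb).symm

end LeadingForm

section ProdForm

variable {n : ℕ} {ι : Type*}

theorem isHomogeneous_linForm (x : Fin n → ℝ) : (linForm x).IsHomogeneous 1 :=
  IsHomogeneous.sum _ _ _ fun i _ => isHomogeneous_C_mul_X _ i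

theorem totalDegree_affForm_le (x : Fin n → ℝ) (c : ℝ) : (affForm x c).totalDegree ≤ 1 :=
  (totalDegree_sub_C_le _ _).trans (isHomogeneous_linForm x).totalDegree_le

theorem homogeneousComponent_affForm (x : Fin n → ℝ) (c : ℝ) :
    homogeneousComponent 1 (affForm x c) = linForm x := by
  rw [affForm, map_sub, homogeneousComponent_of_mem (isHomogeneous_linForm x),
    homogeneousComponent_of_mem (isHomogeneous_C _ _), if_pos rfl, if_neg one_ne_zero, sub_zero]

theorem totalDegree_prod_affForm_le (X : ι → Fin n → ℝ) (lam : ι → ℝ) (Y : Finset ι) :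
    (∏ i ∈ Y, affForm (X i) (lam i)).totalDegree ≤ Y.card :=
  (totalDegree_finsetProd _ _).trans <|
    (Finset.sum_le_card_nsmul _ _ 1 fun i _ => totalDegree_affForm_le (X i) (lam i)).trans_eq
      (mul_one _)

theorem homogeneousComponent_prod_affForm (X : ι → Fin n → ℝ) (lam : ι → ℝ) (Y : Finset ι) :
    homogeneousComponent Y.card (∏ i ∈ Y, affForm (X i) (lam i)) = prodForm X Y := by
  classical
  induction Y using Finset.induction_on with
  | empty => simp [prodForm]
  | insert y Y hy ih =>
    rw [Finset.prod_insert hy, prodForm_insert X hy, Finset.card_insert_of_notMem hy,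
      add_comm Y.card, homogeneousComponent_add_mul (totalDegree_affForm_le _ _)
      (totalDegree_prod_affForm_le X lam Y), homogeneousComponent_affForm, ih]

end ProdForm

section Least

variable {n : ℕ} {ι : Type*} {f : Series n}

theorem coeff_least (f : Series n) (b : Fin n →₀ ℕ) :
    coeff b (least f) = if b.degree = f.order.toNat then MvPowerSeries.coeff b f else 0 := by
  rw [least, MvPowerSeries.coeff_truncTotal_eq_ite, MvPowerSeries.coeff_homogeneousComponent]
  split_ifs with degree_lt degree_eq degree_eq
  · rfl
  · rfl
  · omega
  · rfl

theorem least_ne_zero (hf : f ≠ 0) : least f ≠ 0 := by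
  obtain ⟨b, coeff_ne_zero, degree_eq⟩ := MvPowerSeries.exists_coeff_ne_zero_and_order
    (MvPowerSeries.ne_zero_iff_order_finite.1 hf)
  refine fun h => coeff_ne_zero ?_
  rw [← coeff_zero b, ← h, coeff_least, if_pos (by rw [← degree_eq, ENat.toNat_natCast])]

theorem homogeneousComponent_monomial (d : ℕ) (a : Fin n →₀ ℕ) (c : ℂ) :
    homogeneousComponent d (monomial a c) = if d = a.degree then monomial a c else 0 :=
  homogeneousComponent_of_mem (isHomogeneous_monomial c rfl)

theorem seriesPairing_homogeneousComponent_of_lt {d : ℕ} (hd : d < f.order.toNat) (q : Poly n) :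
    seriesPairing (homogeneousComponent d q) f = 0 := by
  induction q using MvPolynomial.induction_on' with
  | add p q hp hq => rw [map_add, map_add, LinearMap.add_apply, hp, hq, add_zero]
  | monomial a c =>
    rw [homogeneousComponent_monomial]
    split_ifs with degree_eq
    · have degree_lt : (a.degree : ℕ∞) < f.order :=
        (Nat.cast_lt.2 (degree_eq ▸ hd)).trans_le (ENat.natCast_toNat_le_self _)
      rw [seriesPairing_monomial, MvPowerSeries.coeff_of_lt_order degree_lt, mul_zero, mul_zero]
    · rw [map_zero, LinearMap.zero_apply]

theorem seriesPairing_homogeneousComponent_order {q : Poly n}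
    (hq : q.totalDegree ≤ f.order.toNat) :
    seriesPairing (homogeneousComponent f.order.toNat q) f = seriesPairing q f := by
  have q_eq : ∑ d ∈ Finset.range (f.order.toNat + 1), homogeneousComponent d q = q := by
    have range_subset : Finset.range (q.totalDegree + 1) ⊆ Finset.range (f.order.toNat + 1) :=
      Finset.range_subset_range.2 (Nat.succ_le_succ hq)
    refine (Finset.sum_subset range_subset fun d _ hd => ?_).symm.trans (sum_homogeneousComponent q)
    exact homogeneousComponent_eq_zero d q (by rw [Finset.mem_range] at hd; omega)
  conv_rhs => rw [← q_eq]
  rw [map_sum, LinearMap.sum_apply, Finset.sum_range_succ, Finset.sum_eq_zero fun d hd =>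
    seriesPairing_homogeneousComponent_of_lt (Finset.mem_range.1 hd) q, zero_add]

theorem polyPairing_least (q : Poly n) (f : Series n) :
    polyPairing q (least f) = seriesPairing (homogeneousComponent f.order.toNat q) f := by
  induction q using MvPolynomial.induction_on' with
  | add p q hp hq =>
    rw [map_add, LinearMap.add_apply, hp, hq, map_add, map_add, LinearMap.add_apply]
  | monomial a c =>
    rw [polyPairing_monomial, coeff_least, homogeneousComponent_monomial]
    simp only [eq_comm (a := a.degree)]
    split_ifs
    · rw [seriesPairing_monomial]
    · rw [mul_zero, mul_zero, map_zero, LinearMap.zero_apply]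

theorem polyPairing_mul_homogeneousComponent_least {p : Poly n} {k : ℕ} (hp : p.totalDegree ≤ k)
    (h : ∀ q, seriesPairing (q * p) f = 0) (q : Poly n) :
    polyPairing (q * homogeneousComponent k p) (least f) = 0 := by
  induction q using MvPolynomial.induction_on' with
  | add q₁ q₂ h₁ h₂ => rw [add_mul, map_add, LinearMap.add_apply, h₁, h₂, add_zero]
  | monomial a c =>
    have component_mul : homogeneousComponent (a.degree + k) (monomial a c * p) =
        monomial a c * homogeneousComponent k p := by
      rw [homogeneousComponent_add_mul (isHomogeneous_monomial c rfl).totalDegree_le hp,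
        homogeneousComponent_monomial, if_pos rfl]
    rw [polyPairing_least, ← component_mul,
      homogeneousComponent_of_mem (homogeneousComponent_isHomogeneous _ _)]
    split_ifs with degree_eq
    · rw [← degree_eq, seriesPairing_homogeneousComponent_order, h]
      rw [degree_eq]
      exact (totalDegree_mul _ _).trans
        (add_le_add (isHomogeneous_monomial c rfl).totalDegree_le hp)
    · rw [map_zero, LinearMap.zero_apply]

theorem seriesPairing_eq_zero_of_mem_expSpace {V : Set (Fin n → ℝ)} (hf : f ∈ expSpace V)
    {p : Poly n} (hp : ∀ v ∈ V, eval (complexPoint v) p = 0) : seriesPairing p f = 0 := by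
  have expSpace_le_ker : expSpace V ≤ LinearMap.ker (seriesPairing p) :=
    Submodule.span_le.2 <| Set.forall_mem_image.2 fun v hv =>
      (seriesPairing_expSeries p _).trans (hp v hv)
  exact expSpace_le_ker hf

theorem leastSpace_internalVertices_le_internalD [LinearOrder ι] (X : ι → Fin n → ℝ)
    (lam : ι → ℝ) : leastSpace (internalVertices X lam) ≤ internalD X := by
  refine Submodule.span_le.2 (Set.forall_mem_image.2 fun f hf => ?_)
  rw [SetLike.mem_coe, internalD_eq_idealPerp, internalJ, mem_idealPerp_span,
    Set.forall_mem_image]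
  intro Y hY
  rw [← homogeneousComponent_prod_affForm X lam Y]
  refine polyPairing_mul_homogeneousComponent_least (totalDegree_prod_affForm_le X lam Y) fun q =>
    seriesPairing_eq_zero_of_mem_expSpace hf ?_
  rintro v ⟨B, hB, hv⟩
  obtain ⟨i, hi⟩ := hY B hB
  obtain ⟨hiY, hiB⟩ := Finset.mem_inter.1 hi
  rw [map_mul, map_prod, Finset.prod_eq_zero hiY, mul_zero]
  rw [eval_affForm, hv i hiB, sub_self, Complex.ofReal_zero]

end Least

/-! ### Interpolation -/

section Interpolation

open ComplexConjugate

variable {n : ℕ} {V : Set (Fin n → ℝ)}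

theorem seriesPairing_ne_zero_of_coeff_eq_conj {p : Poly n} (hp : p ≠ 0) {f : Series n}
    (h : ∀ b ∈ p.support, MvPowerSeries.coeff b f = conj (coeff b p)) :
    seriesPairing p f ≠ 0 := by
  have pairing_eq : seriesPairing p f = ((∑ b ∈ p.support,
      (∏ i : Fin n, ((b i).factorial : ℝ)) * Complex.normSq (coeff b p) : ℝ) : ℂ) := by
    conv_lhs => rw [← support_sum_monomial_coeff p]
    rw [map_sum, LinearMap.sum_apply, Complex.ofReal_sum]
    refine Finset.sum_congr rfl fun b hb => ?_
    rw [seriesPairing_monomial, h b hb, mul_left_comm, Complex.mul_conj, multiFactorial]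
    push_cast
    rfl
  rw [pairing_eq, Complex.ofReal_ne_zero]
  refine (Finset.sum_pos (fun b hb => mul_pos ?_ ?_) (support_nonempty.2 hp)).ne'
  · exact Finset.prod_pos fun i _ => Nat.cast_pos.2 (Nat.factorial_pos _)
  · exact Complex.normSq_pos.2 (mem_support_iff.1 hb)

theorem seriesPairing_least_map_conj_ne_zero {f : Series n} (hf : f ≠ 0) :
    seriesPairing (least f) (MvPowerSeries.map (starRingEnd ℂ) f) ≠ 0 := by
  refine seriesPairing_ne_zero_of_coeff_eq_conj (least_ne_zero hf) fun b hb => ?_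
  rw [mem_support_iff, coeff_least, ite_ne_right_iff] at hb
  rw [MvPowerSeries.coeff_map, coeff_least, if_pos hb.1]

theorem map_conj_expSeries (v : Fin n → ℝ) :
    MvPowerSeries.map (starRingEnd ℂ) (expSeries (complexPoint v)) =
      expSeries (complexPoint v) := by
  ext a
  simp [coeff_expSeries, complexPoint]

theorem map_conj_mem_expSpace {f : Series n} (hf : f ∈ expSpace V) :
    MvPowerSeries.map (starRingEnd ℂ) f ∈ expSpace V := by
  induction hf using Submodule.span_induction with
  | mem f hf =>
    obtain ⟨v, hv, rfl⟩ := hf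
    exact (map_conj_expSeries v).symm ▸ Submodule.subset_span ⟨v, hv, rfl⟩
  | zero => rw [map_zero]; exact zero_mem _
  | add f g _ _ hf hg => rw [map_add]; exact add_mem hf hg
  | smul c f _ hf =>
    rw [MvPowerSeries.smul_eq_C_mul, map_mul, MvPowerSeries.map_C, ← MvPowerSeries.smul_eq_C_mul]
    exact Submodule.smul_mem _ _ hf

/-- The restriction of polynomials to a set of real points. -/
noncomputable def evalMap (V : Set (Fin n → ℝ)) : Poly n →ₗ[ℂ] V → ℂ :=
  LinearMap.pi fun v => (aeval (complexPoint v) : Poly n →ₐ[ℂ] ℂ).toLinearMap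

theorem evalMap_apply (p : Poly n) (v : V) : evalMap V p v = eval (complexPoint v) p :=
  rfl

theorem isCorrect_iff_bijective_evalMap {P : Submodule ℂ (Poly n)} :
    IsCorrect V P ↔ Function.Bijective ((evalMap V).domRestrict P) :=
  Iff.rfl

theorem exists_mem_expSpace_seriesPairing_eq [Finite V] (φ : Module.Dual ℂ (V → ℂ)) :
    ∃ f ∈ expSpace V, ∀ p, seriesPairing p f = φ (evalMap V p) := by
  classical
  cases nonempty_fintype V
  refine ⟨∑ v : V, φ (fun w => if v = w then 1 else 0) • expSeries (complexPoint v),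
    sum_mem fun v _ => Submodule.smul_mem _ _ (Submodule.subset_span ⟨v, v.2, rfl⟩), fun p => ?_⟩
  rw [map_sum, LinearMap.pi_apply_eq_sum_univ φ]
  refine Finset.sum_congr rfl fun v _ => ?_
  rw [map_smul, seriesPairing_expSeries, evalMap_apply, smul_eq_mul, smul_eq_mul, mul_comm]

/-- Dedekind's independence of characters, applied to the evaluations at the points of `V`. -/
theorem eq_zero_of_forall_evalMap_eq_zero [Finite V] {φ : Module.Dual ℂ (V → ℂ)}
    (h : ∀ p, φ (evalMap V p) = 0) : φ = 0 := by
  classical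
  cases nonempty_fintype V
  have eval_injective : Function.Injective fun v : V =>
      ((eval (complexPoint v) : Poly n →+* ℂ) : Poly n →* ℂ) := by
    intro v w hvw
    ext i
    simpa [complexPoint] using DFunLike.congr_fun hvw (X i)
  have linearIndependent_eval := (linearIndependent_monoidHom (Poly n) ℂ).comp _ eval_injective
  have coefficient_eq_zero (v : V) : φ (fun w => if v = w then 1 else 0) = 0 := by
    refine Fintype.linearIndependent_iff.1 linearIndependent_eval
      (fun v => φ fun w => if v = w then 1 else 0) (_root_.funext fun p => ?_) v
    have sum_eq := h p
    rw [LinearMap.pi_apply_eq_sum_univ φ] at sum_eq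
    simpa [evalMap_apply, mul_comm] using sum_eq
  refine LinearMap.ext fun g => ?_
  rw [LinearMap.pi_apply_eq_sum_univ φ]
  exact Finset.sum_eq_zero fun v _ => by rw [coefficient_eq_zero, smul_zero]

theorem map_evalMap_leastSpace (V : Set (Fin n → ℝ)) [Finite V] :
    (leastSpace V).map (evalMap V) = ⊤ := by
  by_contra hne
  obtain ⟨φ, hφ, map_le_ker⟩ := Submodule.exists_le_ker_of_lt_top _ (lt_top_iff_ne_top.2 hne)
  obtain ⟨f, hf, pairing_eq⟩ := exists_mem_expSpace_seriesPairing_eq φ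
  have f_ne_zero : f ≠ 0 := by
    rintro rfl
    exact hφ (eq_zero_of_forall_evalMap_eq_zero fun p => by rw [← pairing_eq, map_zero])
  set g := MvPowerSeries.map (starRingEnd ℂ) f with hg
  have f_eq : f = MvPowerSeries.map (starRingEnd ℂ) g := by
    ext b
    simp [hg]
  have g_ne_zero : g ≠ 0 := fun h => f_ne_zero (by rw [f_eq, h, map_zero])
  have least_mem : least g ∈ leastSpace V :=
    Submodule.subset_span ⟨g, map_conj_mem_expSpace hf, rfl⟩
  refine seriesPairing_least_map_conj_ne_zero g_ne_zero ?_
  rw [← f_eq, pairing_eq]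
  exact map_le_ker ⟨_, least_mem, rfl⟩

end Interpolation

/-! ### Dimensions -/

section Dimension

variable {n : ℕ} {V : Set (Fin n → ℝ)} {P : Submodule ℂ (Poly n)}

theorem finrank_fun_eq_ncard [Finite V] : Module.finrank ℂ (V → ℂ) = V.ncard := by
  cases nonempty_fintype V
  rw [Module.finrank_fintype_fun_eq_card, ← Nat.card_eq_fintype_card, Nat.card_coe_set_eq]

theorem IsCorrect.finrank_eq [Finite V] (h : IsCorrect V P) :
    Module.finrank ℂ P = V.ncard :=
  (LinearEquiv.ofBijective _ (isCorrect_iff_bijective_evalMap.1 h)).finrank_eq.trans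
    finrank_fun_eq_ncard

theorem finrank_le_ncard_of_injective [Finite V]
    (hinj : Function.Injective ((evalMap V).domRestrict P)) :
    Module.finrank ℂ P ≤ V.ncard :=
  (LinearMap.finrank_le_finrank_of_injective hinj).trans_eq finrank_fun_eq_ncard

theorem ncard_le_finrank_of_leastSpace_le [Finite V] [FiniteDimensional ℂ P]
    (h : leastSpace V ≤ P) : V.ncard ≤ Module.finrank ℂ P := by
  have finrank_map := Submodule.finrank_map_le (evalMap V) P
  rwa [top_unique ((map_evalMap_leastSpace V).ge.trans (Submodule.map_mono h)), finrank_top,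
    finrank_fun_eq_ncard] at finrank_map

theorem isCorrect_of_injective_of_ncard_le [Finite V]
    (hinj : Function.Injective ((evalMap V).domRestrict P))
    (hcard : V.ncard ≤ Module.finrank ℂ P) : IsCorrect V P := by
  have : FiniteDimensional ℂ P := .of_injective _ hinj
  refine isCorrect_iff_bijective_evalMap.2
    ⟨hinj, (LinearMap.injective_iff_surjective_of_finrank_eq_finrank ?_).1 hinj⟩
  rw [finrank_fun_eq_ncard]
  exact (finrank_le_ncard_of_injective hinj).antisymm hcard

theorem isCorrect_of_leastSpace_le_of_finrank_le [Finite V] [FiniteDimensional ℂ P]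
    (h : leastSpace V ≤ P) (hfin : Module.finrank ℂ P ≤ V.ncard) : IsCorrect V P := by
  have surjective : Function.Surjective ((evalMap V).domRestrict P) := by
    rw [← LinearMap.range_eq_top, LinearMap.range_domRestrict]
    exact top_unique ((map_evalMap_leastSpace V).ge.trans (Submodule.map_mono h))
  refine isCorrect_iff_bijective_evalMap.2
    ⟨(LinearMap.injective_iff_surjective_of_finrank_eq_finrank ?_).2 surjective, surjective⟩
  rw [finrank_fun_eq_ncard]
  exact hfin.antisymm (ncard_le_finrank_of_leastSpace_le h)

theorem IsCorrect.leastSpace_eq [Finite V] (hP : IsCorrect V P) (h : leastSpace V ≤ P) :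
    leastSpace V = P := by
  refine h.antisymm fun p hp => ?_
  obtain ⟨q, hq, eval_eq⟩ := (map_evalMap_leastSpace V).ge (Submodule.mem_top (x := evalMap V p))
  obtain rfl : q = p := congrArg Subtype.val
    ((isCorrect_iff_bijective_evalMap.1 hP).1 (a₁ := ⟨q, h hq⟩) (a₂ := ⟨p, hp⟩) eval_eq)
  exact hq

variable {I : Ideal (Poly n)}

theorem finiteDimensional_idealPerp [FiniteDimensional ℂ P]
    (h : P ⊔ I.restrictScalars ℂ = ⊤) : FiniteDimensional ℂ (idealPerp I) :=
  .of_injective _ (polyPairing_injective_of_sup_eq_top h)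

theorem finrank_idealPerp_le [FiniteDimensional ℂ P] (h : P ⊔ I.restrictScalars ℂ = ⊤) :
    Module.finrank ℂ (idealPerp I) ≤ Module.finrank ℂ P :=
  (LinearMap.finrank_le_finrank_of_injective (polyPairing_injective_of_sup_eq_top h)).trans_eq
    Subspace.dual_finrank_eq

theorem polyPairing_bijective_of_finrank_eq [FiniteDimensional ℂ P]
    (h : P ⊔ I.restrictScalars ℂ = ⊤)
    (hfin : Module.finrank ℂ (idealPerp I) = Module.finrank ℂ P) :
    Function.Bijective (polyPairing.domRestrict₁₂ (idealPerp I) P) := by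
  have := finiteDimensional_idealPerp h
  have injective := polyPairing_injective_of_sup_eq_top h
  exact ⟨injective, (LinearMap.injective_iff_surjective_of_finrank_eq_finrank
    (hfin.trans Subspace.dual_finrank_eq.symm)).1 injective⟩

end Dimension

section Internal

variable {n : ℕ} {ι : Type*} [LinearOrder ι] {X : ι → Fin n → ℝ} {lam : ι → ℝ}

theorem evalMap_domRestrict_internalP_injective [Fintype ι]
    (hX : Submodule.span ℝ (Set.range X) = ⊤) (hlam : IsGeneric X lam) :
    Function.Injective ((evalMap (internalVertices X lam)).domRestrict (internalP X)) :=
  (injective_iff_map_eq_zero _).2 fun p hp => Subtype.ext <|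
    eq_zero_of_eval_internalVertices_eq_zero hX hlam p.2 fun v hv => congrFun hp ⟨v, hv⟩

theorem finiteDimensional_internalP [Fintype ι] (hX : Submodule.span ℝ (Set.range X) = ⊤) :
    FiniteDimensional ℂ (internalP X) := by
  obtain ⟨lam, hlam⟩ := exists_isGeneric X
  have := hlam.finite_internalVertices.to_subtype
  exact .of_injective _ (evalMap_domRestrict_internalP_injective hX hlam)

theorem finiteDimensional_internalD [Finite ι] (hX : Submodule.span ℝ (Set.range X) = ⊤) :
    FiniteDimensional ℂ (internalD X) := by
  cases nonempty_fintype ι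
  have := finiteDimensional_internalP hX
  exact internalD_eq_idealPerp X ▸ finiteDimensional_idealPerp (internalP_sup_internalJ hX)

theorem finrank_internalD_le [Fintype ι] (hX : Submodule.span ℝ (Set.range X) = ⊤) :
    Module.finrank ℂ (internalD X) ≤ Module.finrank ℂ (internalP X) := by
  have := finiteDimensional_internalP hX
  exact internalD_eq_idealPerp X ▸ finrank_idealPerp_le (internalP_sup_internalJ hX)

theorem isCorrect_internalP [Fintype ι]
    (hX : Submodule.span ℝ (Set.range X) = ⊤) (hlam : IsGeneric X lam) :
    IsCorrect (internalVertices X lam) (internalP X) := by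
  have := hlam.finite_internalVertices.to_subtype
  have := finiteDimensional_internalD hX
  exact isCorrect_of_injective_of_ncard_le (evalMap_domRestrict_internalP_injective hX hlam) <|
    (ncard_le_finrank_of_leastSpace_le (leastSpace_internalVertices_le_internalD X lam)).trans
      (finrank_internalD_le hX)

theorem isCorrect_internalD [Finite ι]
    (hX : Submodule.span ℝ (Set.range X) = ⊤) (hlam : IsGeneric X lam) :
    IsCorrect (internalVertices X lam) (internalD X) := by
  cases nonempty_fintype ι
  have := hlam.finite_internalVertices.to_subtype
  have := finiteDimensional_internalD hX
  exact isCorrect_of_leastSpace_le_of_finrank_le (leastSpace_internalVertices_le_internalD X lam)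
    ((finrank_internalD_le hX).trans (isCorrect_internalP hX hlam).finrank_eq.le)

theorem internalD_eq_leastSpace [Finite ι] (hX : Submodule.span ℝ (Set.range X) = ⊤)
    (hlam : IsGeneric X lam) : internalD X = leastSpace (internalVertices X lam) := by
  have := hlam.finite_internalVertices.to_subtype
  exact ((isCorrect_internalD hX hlam).leastSpace_eq
    (leastSpace_internalVertices_le_internalD X lam)).symm

theorem finrank_internalP [Fintype ι] (hX : Submodule.span ℝ (Set.range X) = ⊤) :
    Module.finrank ℂ (internalP X) = (internalBases X).ncard := by
  obtain ⟨lam, hlam⟩ := exists_isGeneric X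
  have := hlam.finite_internalVertices.to_subtype
  exact (isCorrect_internalP hX hlam).finrank_eq.trans hlam.ncard_internalVertices

theorem finrank_internalD [Finite ι] (hX : Submodule.span ℝ (Set.range X) = ⊤) :
    Module.finrank ℂ (internalD X) = (internalBases X).ncard := by
  obtain ⟨lam, hlam⟩ := exists_isGeneric X
  have := hlam.finite_internalVertices.to_subtype
  exact (isCorrect_internalD hX hlam).finrank_eq.trans hlam.ncard_internalVertices

theorem polyPairing_internalD_internalP_bijective [Fintype ι]
    (hX : Submodule.span ℝ (Set.range X) = ⊤) :
    Function.Bijective (polyPairing.domRestrict₁₂ (internalD X) (internalP X)) := by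
  have := finiteDimensional_internalP hX
  have finrank_eq := (finrank_internalD hX).trans (finrank_internalP hX).symm
  rw [internalD_eq_idealPerp] at finrank_eq ⊢
  exact polyPairing_bijective_of_finrank_eq (internalP_sup_internalJ hX) finrank_eq

theorem pairing_internalD_internalP_bijective [Fintype ι]
    (hX : Submodule.span ℝ (Set.range X) = ⊤) :
    Function.Bijective (fun f : internalD X =>
      ((pairing (f : Poly n)).comp (toSeries n)).domRestrict (internalP X)) := by
  simp only [pairing_eq_seriesPairing]
  exact polyPairing_internalD_internalP_bijective hX

theorem isCompl_internalP_internalJ [Fintype ι] (hX : Submodule.span ℝ (Set.range X) = ⊤) :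
    IsCompl (internalP X) ((internalJ X).restrictScalars ℂ) := by
  have surjective := (polyPairing_internalD_internalP_bijective hX).2
  rw [internalD_eq_idealPerp] at surjective
  exact ⟨disjoint_of_polyPairing_surjective surjective,
    codisjoint_iff.2 (internalP_sup_internalJ hX)⟩

end Internal

end ZonotopalAlgebra

theorem mainTheorem2 {n : ℕ} {ι : Type*} [Fintype ι] [LinearOrder ι] (X : ι → Fin n → ℝ)
    (hX0 : ∀ i, X i ≠ 0) (hX : Submodule.span ℝ (Set.range X) = ⊤) :
    -- (1) dimensions
    (FiniteDimensional ℂ (internalP X) ∧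
      Module.finrank ℂ (internalP X) = (internalBases X).ncard) ∧
    (FiniteDimensional ℂ (internalD X) ∧
      Module.finrank ℂ (internalD X) = (internalBases X).ncard) ∧
    -- (2) duality under the pairing
    Function.Bijective (fun f : internalD X =>
      (((pairing (f : Poly n)).comp (toSeries n)).domRestrict (internalP X) :
        Module.Dual ℂ (internalP X))) ∧
    -- (3) and (4), for every generic arrangement
    (∀ lam : ι → ℝ, IsGeneric X lam →
      internalD X = leastSpace (internalVertices X lam) ∧
      IsCorrect (internalVertices X lam) (internalD X) ∧
      IsCorrect (internalVertices X lam) (internalP X)) ∧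
    -- (3) continued
    (internalD X).map (toSeries n) = idealKer (internalJ X) ∧
    -- (5)
    (internalP X).map (toSeries n) = idealKer (internalI X) ∧
    -- (6)
    IsCompl (internalP X) ((internalJ X).restrictScalars ℂ) := by
  exact ⟨⟨finiteDimensional_internalP hX, finrank_internalP hX⟩,
    ⟨finiteDimensional_internalD hX, finrank_internalD hX⟩,
    pairing_internalD_internalP_bijective hX,
    fun _ hlam => ⟨internalD_eq_leastSpace hX hlam, isCorrect_internalD hX hlam,
      isCorrect_internalP hX hlam⟩,
    map_internalD_eq_idealKer X, map_internalP_eq_idealKer hX, isCompl_internalP_internalJ hX⟩
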